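/- For indices $1\le i,j\le n$, $i\ne j$, and $c\in\mathbb{R}$ let $H_{ij}(c)=\{x\in\mathbb{R}^n : x_i-x_j=c\}$. A deformed braid arrangement in $\mathbb{R}^n$ is a set of hyperplanes of the form $\{H_{ij}(c) : 1\le i<j\le n,\ c\in C_{ij}\}$ with nonempty finite sets $C_{ij}\subset\mathbb{R}$. For a finite set $\mathcal{A}$ of hyperplanes in $\mathbb{R}^n$ let $L(\mathcal{A})$ be the set of all nonempty intersections of members of $\mathcal{A}$ (including the empty intersection $\mathbb{R}^n$), ordered by reverse inclusion. An exponential sequence of arrangements (ESA) is a sequence $(\mathcal{A}_1,\mathcal{A}_2,\ldots)$ in which each $\mathcal{A}_n$ is a deformed braid arrangement in $\mathbb{R}^n$ and, for every $n\ge 1$ and every nonempty $S\subseteq\{1,\ldots,n\}$, the posets $L(\mathcal{A}_n^S)$ and $L(\mathcal{A}_{|S|})$ are isomorphic, where $\mathcal{A}_n^S$ is the set of those $H\in\mathcal{A}_n$ that are parallel to $x_i-x_j=0$ for some distinct $i,j\in S$. A face of $\mathcal{A}$ is a connected component of $X\setminus\bigcup_{H\in\mathcal{A},\,X\not\subseteq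 H}H$ for some $X\in L(\mathcal{A})$; its dimension is the dimension of its affine span. The level of a subset $F\subseteq\mathbb{R}^n$ is the smallest dimension of a linear subspace $W\subseteq\mathbb{R}^n$ such that the distances $d(x,W)$, $x\in F$, are uniformly bounded. Let $f_{d,l}(\mathcal{A})$ be the number of faces of $\mathcal{A}$ of dimension $d$ and level $l$. **Theorem.** Let $(\mathcal{A}_1,\mathcal{A}_2,\ldots)$ be an ESA, and for every integer $l\ge 1$ put $$F_l(x,y)=\sum_{n\ge d\ge l} f_{d,l}(\mathcal{A}_n)\,x^{n-d}\,\frac{y^n}{n!}.$$ Then for every $l\ge 1$ $$F_l(x,y)=\bigl(F_1(x,y)\bigr)^l.$$ Equivalently, for all integers $n\ge d\ge l\ge 1$, $$f_{d,l}(\mathcal{A}_n)=\sum_{\substack{n_1+\cdots+n_l=n,\ d_1+\cdots+d_l=d\\ n_i\ge d_i\ge 1}}\binom{n}{n_1,\ldots,n_l}\prod_{i=1}^{l}f_{d_i,1}(\mathcal{A}_{n_i}).$$ -/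

import Mathlib

open scoped Polynomial

noncomputable section

/-- Euclidean space `ℝⁿ`. -/
abbrev RSpace (n : ℕ) : Type := EuclideanSpace ℝ (Fin n)

/-- A collection of affine subspaces of `ℝⁿ`; the arrangements of the theorem are finite sets of
hyperplanes, see `IsDeformedBraid`. -/
abbrev Arrangement (n : ℕ) : Type := Set (AffineSubspace ℝ (RSpace n))

/-- The affine subspace `{x ∈ ℝⁿ | x_i - x_j = c}` (a hyperplane when `i ≠ j`). -/
def diffHyperplane {n : ℕ} (i j : Fin n) (c : ℝ) : AffineSubspace ℝ (RSpace n) where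
  carrier := {x | x i - x j = c}
  smul_vsub_vadd_mem' := by
    intro t p q r hp hq hr
    simp only [Set.mem_ofPred_eq, vsub_eq_sub, vadd_eq_add, PiLp.add_apply, PiLp.smul_apply,
      PiLp.sub_apply, smul_eq_mul] at *
    linear_combination t * hp - t * hq + hr

/-- Deformed braid arrangement in `ℝⁿ`: the hyperplanes `x_i - x_j = c` for `i < j` and `c` in a
nonempty finite set `a i j` of reals. -/
def IsDeformedBraid {n : ℕ} (A : Arrangement n) : Prop :=
  ∃ a : Fin n → Fin n → Finset ℝ,
    (∀ i j, i < j → (a i j).Nonempty) ∧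
    A = {H | ∃ i j, i < j ∧ ∃ c ∈ a i j, H = diffHyperplane i j c}

/-- The nonempty intersections of members of `A`; the empty intersection is `ℝⁿ`. -/
def flats {n : ℕ} (A : Arrangement n) : Set (AffineSubspace ℝ (RSpace n)) :=
  {X | (∃ B ⊆ A, X = sInf B) ∧ (X : Set (RSpace n)).Nonempty}

/-- The intersection poset `L(A)`: the flats, ordered by reverse inclusion. -/
abbrev IntersectionPoset {n : ℕ} (A : Arrangement n) : Type := (flats A)ᵒᵈ

/-- `A^S`: the members of `A` parallel to `x_i - x_j = 0` for some distinct `i, j ∈ S`. -/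
def subarrangement {n : ℕ} (A : Arrangement n) (S : Finset (Fin n)) : Arrangement n :=
  {H ∈ A | ∃ i ∈ S, ∃ j ∈ S, i ≠ j ∧ H.Parallel (diffHyperplane i j 0)}

/-- Exponential sequence of arrangements `(A 1, A 2, …)`; the term `A 0` is not constrained (and
never used). -/
structure IsESA (A : ∀ n : ℕ, Arrangement n) : Prop where
  deformedBraid : ∀ n, 1 ≤ n → IsDeformedBraid (A n)
  iso : ∀ n, 1 ≤ n → ∀ S : Finset (Fin n), S.Nonempty →
    Nonempty (IntersectionPoset (subarrangement (A n) S) ≃o IntersectionPoset (A S.card))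

/-- The complement `M(A/X)`: the points of `X` on no member of `A` that does not contain `X`. -/
def restrictionComplement {n : ℕ} (A : Arrangement n) (X : AffineSubspace ℝ (RSpace n)) :
    Set (RSpace n) :=
  (X : Set (RSpace n)) \ ⋃ H ∈ {H ∈ A | ¬ X ≤ H}, (H : Set (RSpace n))

/-- Faces of `A`: the connected components of the sets `M(A/X)`, where `X` ranges over `L(A)`. -/
def IsFace {n : ℕ} (A : Arrangement n) (F : Set (RSpace n)) : Prop :=
  ∃ X ∈ flats A, ∃ x ∈ restrictionComplement A X,
    F = connectedComponentIn (restrictionComplement A X) x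

/-- Dimension of a face: the dimension of its affine span. -/
def faceDim {n : ℕ} (F : Set (RSpace n)) : ℕ :=
  Module.finrank ℝ (vectorSpan ℝ F)

/-- The level of a subset `F` of `ℝⁿ`: the smallest dimension of a linear subspace `W` such that
the distances of the points of `F` to `W` are uniformly bounded. -/
def level {n : ℕ} (F : Set (RSpace n)) : ℕ :=
  sInf {k | ∃ W : Submodule ℝ (RSpace n), Module.finrank ℝ W = k ∧
    ∃ r : ℝ, ∀ x ∈ F, Metric.infDist x (W : Set (RSpace n)) ≤ r}

/-- The set of faces of `A` of dimension `d` and level `l`. -/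
def facesOf {n : ℕ} (A : Arrangement n) (d l : ℕ) : Set (Set (RSpace n)) :=
  {F | IsFace A F ∧ faceDim F = d ∧ level F = l}

/-- `f_{d,l}(A)`: the number of faces of `A` of dimension `d` and level `l`. -/
def faceCount {n : ℕ} (A : Arrangement n) (d l : ℕ) : ℕ :=
  (facesOf A d l).ncard

/-- `F_l(x,y) = ∑_{n ≥ d ≥ l} f_{d,l}(A_n) x^{n-d} y^n / n!`, as a power series in `y` whose
coefficients are polynomials in `x`. -/
def levelGF (A : ∀ n : ℕ, Arrangement n) (l : ℕ) : PowerSeries ℚ[X] :=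
  PowerSeries.mk fun n =>
    ∑ d ∈ Finset.Icc l n,
      Polynomial.C ((faceCount (A n) d l : ℚ) / (n.factorial : ℚ)) * Polynomial.X ^ (n - d)

/-- The sets counted by `faceCount` are finite, so that `Set.ncard` is their cardinality. -/
theorem IsDeformedBraid.facesOf_finite {n : ℕ} {A : Arrangement n} (hA : IsDeformedBraid A)
    (d l : ℕ) : (facesOf A d l).Finite := by
  classical
  obtain ⟨a, -, rfl⟩ := hA
  set A : Arrangement n := {H | ∃ i j, i < j ∧ ∃ c ∈ a i j, H = diffHyperplane i j c} with hA
  let T : Finset (Fin n × Fin n × ℝ) :=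
    Finset.univ.biUnion fun i => Finset.univ.biUnion fun j =>
      (a i j).image fun c => (i, j, c)
  have hAfin : A.Finite := by
    refine ((T.finite_toSet).image fun t => diffHyperplane t.1 t.2.1 t.2.2).subset ?_
    rintro H ⟨i, j, -, c, hc, rfl⟩
    exact ⟨(i, j, c), by simpa [T] using hc, rfl⟩
  have hL : (flats A).Finite := by
    refine (hAfin.finite_subsets.image sInf).subset ?_
    rintro X ⟨⟨B, hB, rfl⟩, -⟩
    exact ⟨B, hB, rfl⟩
  have key : ∀ X ∈ flats A, ((fun x => connectedComponentIn (restrictionComplement A X) x) ''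
      restrictionComplement A X).Finite := by
    intro X _
    let p : RSpace n → Finset (Fin n × Fin n × ℝ) :=
      fun x => T.filter fun t => x t.1 - x t.2.1 < t.2.2
    have hp : (p '' restrictionComplement A X).Finite := by
      refine (T.powerset.finite_toSet).subset ?_
      rintro _ ⟨x, -, rfl⟩
      exact Finset.mem_coe.2 (Finset.mem_powerset.2 (Finset.filter_subset _ _))
    have hcomp : ∀ x ∈ restrictionComplement A X, ∀ y ∈ restrictionComplement A X, p x = p y →
        connectedComponentIn (restrictionComplement A X) x =
          connectedComponentIn (restrictionComplement A X) y := by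
      intro x hx y hy hxy
      apply connectedComponentIn_eq
      refine (convex_segment y x).isPreconnected.subset_connectedComponentIn
        (right_mem_segment ℝ y x) ?_ (left_mem_segment ℝ y x)
      intro z hz
      refine ⟨X.convex.segment_subset hy.1 hx.1 hz, ?_⟩
      simp only [Set.mem_iUnion, not_exists]
      rintro H ⟨⟨i, j, hij, c, hc, rfl⟩, hXH⟩ hzH
      have hmem : diffHyperplane i j c ∈ {H ∈ A | ¬ X ≤ H} := ⟨⟨i, j, hij, c, hc, rfl⟩, hXH⟩
      have hx' : x i - x j ≠ c := fun h => hx.2 (Set.mem_biUnion hmem h)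
      have hy' : y i - y j ≠ c := fun h => hy.2 (Set.mem_biUnion hmem h)
      have hz' : z i - z j = c := hzH
      have hT : (i, j, c) ∈ T := by simpa [T] using hc
      have hiff : x i - x j < c ↔ y i - y j < c := by
        have := congrArg (fun s => (i, j, c) ∈ s) hxy
        simpa [p, hT] using this
      obtain ⟨s, t, hs, ht, hst, rfl⟩ := hz
      simp only [PiLp.add_apply, PiLp.smul_apply, smul_eq_mul] at hz'
      have e : s * (y i - y j - c) + t * (x i - x j - c) = 0 := by
        linear_combination hz' - c * hst
      rcases lt_or_gt_of_ne hx' with h | h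
      · have h2 := hiff.1 h
        rcases hs.eq_or_lt with rfl | hs
        · have : t = 1 := by linarith
          subst this; linarith
        · nlinarith [mul_pos hs (sub_pos.2 h2), mul_nonneg ht (sub_pos.2 h).le]
      · have h2 : c < y i - y j := lt_of_le_of_ne (not_lt.1 fun h3 => absurd (hiff.2 h3) h.not_gt)
          hy'.symm
        rcases hs.eq_or_lt with rfl | hs
        · have : t = 1 := by linarith
          subst this; linarith
        · nlinarith [mul_pos hs (sub_pos.2 h2), mul_nonneg ht (sub_pos.2 h).le]
    choose! q hq hqp using
      fun (s : Finset (Fin n × Fin n × ℝ)) (hs : s ∈ p '' restrictionComplement A X) => hs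
    refine (hp.image fun s => connectedComponentIn (restrictionComplement A X) (q s)).subset ?_
    rintro _ ⟨x, hx, rfl⟩
    have h := Set.mem_image_of_mem p hx
    exact ⟨p x, h, hcomp _ (hq _ h) _ hx (hqp _ h)⟩
  refine (hL.biUnion key).subset ?_
  rintro F ⟨⟨X, hX, x, hx, rfl⟩, -⟩
  exact Set.mem_biUnion hX ⟨x, hx, rfl⟩

end

/-!
A face of the arrangement on `S` is determined by its sign vector, recording the side of each
hyperplane `x_i - x_j = c` on which it lies (`isFace_iff`). Say that `i` dominates `j` if `x_i - x_j`
is bounded below on the face. Every pair of coordinates is compared by some hyperplane, so this is a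
total preorder, and its classes are the blocks of the face. The level of the face is its number of
blocks (`level_fiber`): the face stays close to the space of vectors constant on the blocks, and a
set of blocks closed upwards can be moved up without leaving the face.

A face on `S` is glued from its restriction to the highest block `T`, which is a face of level `1`
on `T`, and its restriction to `S \ T`; conversely any two such faces can be glued by moving `T`
up far enough. Levels and codimensions add, so the polynomials counting faces by level and
codimension satisfy `levelPoly_succ`, a convolution over the subsets `T` of `S`.

It remains to see that in an exponential sequence these polynomials depend on `S` only through
`|S|` (`levelPoly_eq_of_iso`). For the total over all levels this follows from the intersection
poset: the faces inside a flat `X` satisfy the Euler relation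
`∑ (-1) ^ dim F = (-1) ^ dim X` (`sum_signVectors_neg_one_pow`, by adding the hyperplanes one at a
time), which is a recursion over the poset for the number of faces that span a given flat
(`faceNumber_orderIso`), while the codimension grows by one along covers
(`flatCodim_orderIso`). By induction on `|S|` the levels above `1` are determined through the
convolution, and level `1` is what remains of the total.

With the dependence on `|S|` alone, the convolution reads `F_{l+1} = F_1 * F_l` for the exponential
generating functions, and the multinomial formula compares the coefficients in `F_l = F_1 ^ l`.
-/

noncomputable section

/-! ### Sign vectors of finite families of affine functionals -/

section SignVectors

variable {V ι : Type*} [AddCommGroup V] [Module ℝ V]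

/-- The vectors along which the functionals with sign `0` in `s` do not change. -/
def zeroDirection (φ : ι → V →ₗ[ℝ] ℝ) (s : ι → SignType) : Submodule ℝ V :=
  ⨅ i, ⨅ _ : s i = 0, LinearMap.ker (φ i)

theorem mem_zeroDirection {φ : ι → V →ₗ[ℝ] ℝ} {s : ι → SignType} {v : V} :
    v ∈ zeroDirection φ s ↔ ∀ i, s i = 0 → φ i v = 0 := by
  simp [zeroDirection, Submodule.mem_iInf]

variable [DecidableEq ι]

/-- The sign vector of the point `x` for the affine functionals `φ i - c i`, `i ∈ I`. The entries
outside `I` get the value `1`, so that the zero entries of a sign vector are exactly the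
functionals of the family that vanish at `x`. -/
def signVector (φ : ι → V →ₗ[ℝ] ℝ) (c : ι → ℝ) (I : Finset ι) (x : V) : ι → SignType :=
  fun i => if i ∈ I then SignType.sign (φ i x - c i) else 1

variable {φ : ι → V →ₗ[ℝ] ℝ} {c : ι → ℝ} {I : Finset ι}

theorem signVector_of_mem {i : ι} (hi : i ∈ I) (x : V) :
    signVector φ c I x i = SignType.sign (φ i x - c i) := if_pos hi

theorem signVector_of_notMem {i : ι} (hi : i ∉ I) (x : V) : signVector φ c I x i = 1 := if_neg hi

theorem signVector_eq_zero_iff {i : ι} {x : V} :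
    signVector φ c I x i = 0 ↔ i ∈ I ∧ φ i x = c i := by
  by_cases hi : i ∈ I
  · simp [signVector_of_mem hi, sign_eq_zero_iff, hi, sub_eq_zero]
  · simp [signVector_of_notMem hi, hi]

theorem signVector_eq_iff {x y : V} :
    signVector φ c I x = signVector φ c I y ↔
      ∀ i ∈ I, SignType.sign (φ i x - c i) = SignType.sign (φ i y - c i) := by
  constructor
  · intro h i hi
    have := congrFun h i
    rwa [signVector_of_mem hi, signVector_of_mem hi] at this
  · intro h
    funext i
    by_cases hi : i ∈ I
    · rw [signVector_of_mem hi, signVector_of_mem hi, h i hi]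
    · rw [signVector_of_notMem hi, signVector_of_notMem hi]

theorem finite_range_signVector (φ : ι → V →ₗ[ℝ] ℝ) (c : ι → ℝ) (I : Finset ι) :
    (Set.range (signVector φ c I)).Finite := by
  refine (Set.finite_range fun (r : I → SignType) (i : ι) =>
    if h : i ∈ I then r ⟨i, h⟩ else 1).subset ?_
  rintro _ ⟨x, rfl⟩
  refine ⟨fun i => SignType.sign (φ i x - c i), ?_⟩
  funext i
  by_cases hi : i ∈ I <;> simp [signVector, hi]

/-- The sign vectors of the points of `X`. -/
def signVectors (φ : ι → V →ₗ[ℝ] ℝ) (c : ι → ℝ) (I : Finset ι) (X : Set V) :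
    Finset (ι → SignType) :=
  ((finite_range_signVector φ c I).subset (Set.image_subset_range _ X)).toFinset

theorem mem_signVectors {X : Set V} {s : ι → SignType} :
    s ∈ signVectors φ c I X ↔ ∃ x ∈ X, signVector φ c I x = s := by
  simp [signVectors]

theorem sub_mem_zeroDirection {x y : V} (h : signVector φ c I x = signVector φ c I y) :
    x - y ∈ zeroDirection φ (signVector φ c I x) := by
  rw [mem_zeroDirection]
  intro i hi
  have h1 := signVector_eq_zero_iff.1 hi
  rw [h] at hi
  have h2 := signVector_eq_zero_iff.1 hi
  rw [map_sub, h1.2, h2.2, sub_self]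

theorem convex_signVector_fiber (s : ι → SignType) : Convex ℝ {x | signVector φ c I x = s} := by
  have h : {x | signVector φ c I x = s} = ⋂ i, {x | signVector φ c I x i = s i} := by
    ext x; simp [funext_iff]
  rw [h]
  refine convex_iInter fun i => ?_
  by_cases hi : i ∈ I
  · simp only [signVector_of_mem hi]
    rcases hs : s i with _ | _ | _
    · simpa [sign_eq_zero_iff, sub_eq_zero] using convex_hyperplane (φ i).isLinear (c i)
    · simpa [sign_eq_neg_one_iff] using convex_halfSpace_lt (φ i).isLinear (c i)
    · simpa [sign_eq_one_iff] using convex_halfSpace_gt (φ i).isLinear (c i)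
  · simp only [signVector_of_notMem hi]
    by_cases h1 : 1 = s i
    · simpa [h1] using convex_univ
    · simpa [h1] using convex_empty

open Filter Topology in
/-- The fibres of the sign vector are relatively open: a small move along the zero direction does
not change the sign vector. -/
theorem eventually_signVector_eq (x : V) {u : V}
    (hu : u ∈ zeroDirection φ (signVector φ c I x)) :
    ∀ᶠ t : ℝ in 𝓝 0, signVector φ c I (x + t • u) = signVector φ c I x := by
  simp only [signVector_eq_iff]
  rw [Finset.eventually_all]
  intro i hi
  have hc : Tendsto (fun t : ℝ => φ i (x + t • u) - c i) (𝓝 0) (𝓝 (φ i x - c i)) := by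
    have : Continuous fun t : ℝ => φ i x + t * φ i u - c i := by fun_prop
    simpa using this.tendsto 0
  rcases lt_trichotomy (φ i x - c i) 0 with h | h | h
  · filter_upwards [hc.eventually (gt_mem_nhds h)] with t ht
    rw [sign_neg h, sign_neg ht]
  · have h0 : φ i u = 0 := mem_zeroDirection.1 hu i
      (signVector_eq_zero_iff.2 ⟨hi, sub_eq_zero.1 h⟩)
    simp [h0]
  · filter_upwards [hc.eventually (lt_mem_nhds h)] with t ht
    rw [sign_pos h, sign_pos ht]

theorem finrank_inf_ker_add_one [FiniteDimensional ℝ V] {D : Submodule ℝ V} {f : V →ₗ[ℝ] ℝ}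
    {u : V} (hu : u ∈ D) (hf : f u ≠ 0) :
    Module.finrank ℝ ↥(D ⊓ LinearMap.ker f) + 1 = Module.finrank ℝ D := by
  have h1 := (f.domRestrict D).finrank_range_add_finrank_ker
  have h2 : LinearMap.range (f.domRestrict D) = ⊤ := by
    refine LinearMap.range_eq_top.2 (LinearMap.surjective ?_)
    intro h
    exact hf (by simpa using LinearMap.congr_fun h ⟨u, hu⟩)
  have h3 : (LinearMap.ker (f.domRestrict D)).map D.subtype = D ⊓ LinearMap.ker f := by
    ext v; simp [LinearMap.mem_ker, and_comm]
  rw [h2, finrank_top, Module.finrank_self] at h1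
  rw [← h3, Submodule.finrank_map_subtype_eq, ← h1, add_comm]

theorem signVector_insert {i : ι} (hi : i ∉ I) (x : V) :
    signVector φ c (insert i I) x =
      Function.update (signVector φ c I x) i (SignType.sign (φ i x - c i)) := by
  funext j
  by_cases hj : j = i
  · subst hj; simp [signVector]
  · simp [signVector, hj]

theorem zeroDirection_update_zero {i : ι} {s : ι → SignType} (hs : s i = 1) :
    zeroDirection φ (Function.update s i 0) = zeroDirection φ s ⊓ LinearMap.ker (φ i) := by
  ext v
  simp only [Submodule.mem_inf, mem_zeroDirection, LinearMap.mem_ker]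
  constructor
  · intro h
    refine ⟨fun j hj => h j ?_, h i (by simp)⟩
    rw [Function.update_of_ne _, hj]
    rintro rfl
    simp [hs] at hj
  · rintro ⟨h1, h2⟩ j hj
    by_cases hji : j = i
    · rw [hji, h2]
    · exact h1 j (by rwa [Function.update_of_ne hji] at hj)

theorem zeroDirection_update_of_ne_zero {i : ι} {s : ι → SignType} (hs : s i = 1) {ε : SignType}
    (hε : ε ≠ 0) : zeroDirection φ (Function.update s i ε) = zeroDirection φ s := by
  ext v
  simp only [mem_zeroDirection]
  refine forall_congr' fun j => ?_
  by_cases hji : j = i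
  · subst hji; simp [hs, hε]
  · rw [Function.update_of_ne hji]

open Filter Topology in
/-- Adding one functional to the family cuts a relatively open fibre into one or three pieces, and
does not change its Euler characteristic. -/
theorem sum_sign_split [FiniteDimensional ℝ V] (X : AffineSubspace ℝ V) (i : ι) {x₀ : V}
    (hx₀ : x₀ ∈ X) {s : ι → SignType} (hs : signVector φ c I x₀ = s) {D : Submodule ℝ V}
    (hD : D = X.direction ⊓ zeroDirection φ s) (P : SignType → Prop) [DecidablePred P]
    (hP : ∀ ε, P ε ↔ ∃ x ∈ X, signVector φ c I x = s ∧ SignType.sign (φ i x - c i) = ε) :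
    ∑ ε : SignType with P ε,
      (if ε = 0 then (-1 : ℤ) ^ Module.finrank ℝ ↥(D ⊓ LinearMap.ker (φ i))
        else (-1) ^ Module.finrank ℝ D) = (-1) ^ Module.finrank ℝ D := by
  have hP₀ : P (SignType.sign (φ i x₀ - c i)) := (hP _).2 ⟨x₀, hx₀, hs, rfl⟩
  have hmid : P 1 → P (-1) → P 0 := by
    rw [hP, hP, hP]
    rintro ⟨x, hx, hxs, hx1⟩ ⟨y, hy, hys, hy1⟩
    rw [sign_eq_one_iff] at hx1
    rw [sign_eq_neg_one_iff] at hy1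
    set p := φ i x - c i
    set q := φ i y - c i
    have hpq : 0 < p - q := by linarith
    have hconv := (X.convex.inter (convex_signVector_fiber (φ := φ) (c := c) (I := I) s))
      ⟨hx, hxs⟩ ⟨hy, hys⟩ (a := -q / (p - q)) (b := p / (p - q)) (by
        apply div_nonneg <;> linarith) (by apply div_nonneg <;> linarith) (by
        field_simp; ring)
    refine ⟨_, hconv.1, hconv.2, ?_⟩
    rw [sign_eq_zero_iff, map_add, map_smul, map_smul, smul_eq_mul, smul_eq_mul]
    have h1 : φ i x = p + c i := by simp [p]
    have h2 : φ i y = q + c i := by simp [q]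
    rw [h1, h2]
    field_simp
    ring
  have hcut : ∀ u ∈ D, φ i u ≠ 0 → P 0 → P 1 ∧ P (-1) := by
    intro u hu hφu
    wlog hpos : 0 < φ i u generalizing u
    · exact this (-u) (D.neg_mem hu) (by simpa using hφu) (by
        rw [map_neg]; rcases lt_or_gt_of_ne hφu with h | h
        · linarith
        · exact absurd h hpos)
    rw [hP, hP, hP]
    rintro ⟨x, hx, hxs, hx0⟩
    rw [sign_eq_zero_iff] at hx0
    rw [hD] at hu
    have hu2 : u ∈ zeroDirection φ (signVector φ c I x) := by rw [hxs]; exact hu.2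
    obtain ⟨ε, hε, hball⟩ := Metric.eventually_nhds_iff.1 (eventually_signVector_eq x hu2)
    have hmem : ∀ t : ℝ, x + t • u ∈ X := fun t => by
      have := AffineSubspace.vadd_mem_of_mem_direction (X.direction.smul_mem t hu.1) hx
      rwa [vadd_eq_add, add_comm] at this
    have hval : ∀ t : ℝ, φ i (x + t • u) - c i = t * φ i u := fun t => by
      rw [map_add, map_smul, smul_eq_mul]; linarith
    refine ⟨⟨x + (ε / 2) • u, hmem _, ?_, ?_⟩, ⟨x + (-(ε / 2)) • u, hmem _, ?_, ?_⟩⟩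
    · rw [hball, hxs]
      rw [Real.dist_eq, sub_zero, abs_of_pos (by linarith)]; linarith
    · rw [hval, sign_eq_one_iff]; positivity
    · rw [hball, hxs]
      rw [Real.dist_eq, sub_zero, abs_neg, abs_of_pos (by linarith)]; linarith
    · rw [hval, sign_eq_neg_one_iff]
      have : 0 < ε / 2 * φ i u := by positivity
      linarith
  have huniq : (∀ u ∈ D, φ i u = 0) → ∀ ε, P ε → ε = SignType.sign (φ i x₀ - c i) := by
    intro h ε hε
    obtain ⟨x, hx, hxs, rfl⟩ := (hP ε).1 hε
    have h1 : x - x₀ ∈ D := by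
      rw [hD]
      refine ⟨AffineSubspace.vsub_mem_direction hx hx₀, ?_⟩
      have := sub_mem_zeroDirection (hxs.trans hs.symm)
      rwa [hxs] at this
    have h2 := h _ h1
    rw [map_sub, sub_eq_zero] at h2
    rw [h2]
  have huniv : (Finset.univ : Finset SignType) = {0, -1, 1} := rfl
  rw [Finset.sum_filter, huniv, Finset.sum_insert (by decide), Finset.sum_insert (by decide),
    Finset.sum_singleton]
  simp only [if_true, show ((-1 : SignType) = 0) = False by simp,
    show ((1 : SignType) = 0) = False by simp, if_false]
  by_cases hφ : ∀ u ∈ D, φ i u = 0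
  · have hDD : D ⊓ LinearMap.ker (φ i) = D := inf_eq_left.2 fun u hu => hφ u hu
    rw [hDD]
    have hu := huniq hφ
    rcases hsg : SignType.sign (φ i x₀ - c i) with _ | _ | _ <;>
      rw [hsg] at hP₀ hu
    · have h1 : ¬ P 1 := fun h => absurd (hu _ h) (by decide)
      have h2 : ¬ P (-1) := fun h => absurd (hu _ h) (by decide)
      simp [h1, h2, show P 0 from hP₀]
    · have h1 : ¬ P 1 := fun h => absurd (hu _ h) (by decide)
      have h2 : ¬ P 0 := fun h => absurd (hu _ h) (by decide)
      simp [h1, h2, show P (-1) from hP₀]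
    · have h1 : ¬ P 0 := fun h => absurd (hu _ h) (by decide)
      have h2 : ¬ P (-1) := fun h => absurd (hu _ h) (by decide)
      simp [h1, h2, show P 1 from hP₀]
  · push Not at hφ
    obtain ⟨u, hu, hφu⟩ := hφ
    by_cases h0 : P 0
    · obtain ⟨h1, h2⟩ := hcut u hu hφu h0
      rw [if_pos h0, if_pos h1, if_pos h2, ← finrank_inf_ker_add_one hu hφu]
      ring
    · rw [if_neg h0]
      by_cases h1 : P 1
      · have h2 : ¬ P (-1) := fun h => h0 (hmid h1 h)
        simp [h1, h2]
      · have h2 : P (-1) := by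
          rcases hsg : SignType.sign (φ i x₀ - c i) with _ | _ | _ <;> rw [hsg] at hP₀
          · exact absurd hP₀ h0
          · exact hP₀
          · exact absurd hP₀ h1
        simp [h1, h2]

/-- **Euler relation**: the relatively open faces cut out on an affine subspace `X` by finitely
many affine functionals have alternating sum `(-1) ^ dim X`. -/
theorem sum_signVectors_neg_one_pow [FiniteDimensional ℝ V] (X : AffineSubspace ℝ V)
    (hX : (X : Set V).Nonempty) (I : Finset ι) :
    ∑ s ∈ signVectors φ c I X, (-1 : ℤ) ^ Module.finrank ℝ ↥(X.direction ⊓ zeroDirection φ s) =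
      (-1) ^ Module.finrank ℝ X.direction := by
  classical
  induction I using Finset.induction_on with
  | empty =>
    have h : signVectors φ c ∅ (X : Set V) = {fun _ => 1} := by
      ext s
      rw [mem_signVectors, Finset.mem_singleton]
      obtain ⟨x, hx⟩ := hX
      refine ⟨?_, fun h => ⟨x, hx, ?_⟩⟩
      · rintro ⟨y, -, rfl⟩; rfl
      · rw [h]; rfl
    have h2 : zeroDirection φ (fun _ => (1 : SignType)) = ⊤ := by
      ext v; simp [mem_zeroDirection]
    rw [h, Finset.sum_singleton, h2, inf_top_eq]
  | insert i I hi ih =>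
    rw [← ih]
    have hmaps : ∀ s ∈ signVectors φ c (insert i I) (X : Set V),
        Function.update s i 1 ∈ signVectors φ c I (X : Set V) := by
      intro s hs
      obtain ⟨x, hx, rfl⟩ := mem_signVectors.1 hs
      refine mem_signVectors.2 ⟨x, hx, ?_⟩
      rw [signVector_insert hi, Function.update_idem, eq_comm, Function.update_eq_self_iff,
        signVector_of_notMem hi]
    rw [← Finset.sum_fiberwise_of_maps_to hmaps]
    refine Finset.sum_congr rfl fun s hs => ?_
    obtain ⟨x₀, hx₀, rfl⟩ := mem_signVectors.1 hs
    set s := signVector φ c I x₀ with hsdef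
    rw [← sum_sign_split X i hx₀ hsdef.symm rfl (fun ε => ∃ x ∈ X, signVector φ c I x = s ∧
      SignType.sign (φ i x - c i) = ε) fun _ => Iff.rfl]
    have hsi : s i = 1 := signVector_of_notMem hi x₀
    symm
    refine Finset.sum_nbij (fun ε => Function.update s i ε) ?_ ?_ ?_ ?_
    · intro ε hε
      obtain ⟨x, hx, hxs, rfl⟩ := (Finset.mem_filter.1 hε).2
      refine Finset.mem_filter.2 ⟨mem_signVectors.2 ⟨x, hx, ?_⟩, ?_⟩
      · rw [signVector_insert hi, hxs]
      · rw [Function.update_idem, Function.update_eq_self_iff, hsi]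
    · intro ε _ ε' _ h
      simpa using congrFun h i
    · intro s' hs'
      obtain ⟨h1, h2⟩ := Finset.mem_filter.1 (Finset.mem_coe.1 hs')
      obtain ⟨x, hx, rfl⟩ := mem_signVectors.1 h1
      rw [signVector_insert hi, Function.update_idem, Function.update_eq_self_iff.2
        (signVector_of_notMem hi x).symm] at h2
      refine ⟨SignType.sign (φ i x - c i), ?_, ?_⟩
      · simp only [Finset.coe_filter, Finset.mem_univ, true_and, Set.mem_ofPred_eq]
        exact ⟨x, hx, h2, rfl⟩
      · simp only
        rw [signVector_insert hi, h2]
    · intro ε _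
      by_cases hε : ε = 0
      · subst hε
        rw [if_pos rfl, zeroDirection_update_zero hsi, inf_assoc]
      · rw [if_neg hε, zeroDirection_update_of_ne_zero hsi hε]

end SignVectors

/-! ### Faces and the intersection poset -/

section IntersectionPoset

variable {n : ℕ}

/-- The linear functional `x_i - x_j` attached to a triple `(i, j, c)`. -/
def diffForm (t : Fin n × Fin n × ℝ) : RSpace n →ₗ[ℝ] ℝ where
  toFun x := x t.1 - x t.2.1
  map_add' x y := by simp only [PiLp.add_apply]; ring
  map_smul' r x := by simp only [PiLp.smul_apply, smul_eq_mul, RingHom.id_apply]; ring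

theorem diffForm_apply (t : Fin n × Fin n × ℝ) (x : RSpace n) :
    diffForm t x = x t.1 - x t.2.1 := rfl

/-- The arrangement of the hyperplanes `x_i - x_j = c`, `(i, j, c) ∈ I`. -/
def tripleArrangement (I : Finset (Fin n × Fin n × ℝ)) : Arrangement n :=
  (fun t : Fin n × Fin n × ℝ => diffHyperplane t.1 t.2.1 t.2.2) '' I

theorem mem_diffHyperplane {t : Fin n × Fin n × ℝ} {x : RSpace n} :
    x ∈ diffHyperplane t.1 t.2.1 t.2.2 ↔ diffForm t x = t.2.2 := Iff.rfl

/-- The sign vector of a point for the hyperplanes `x_i - x_j = c`, `(i, j, c) ∈ I`. -/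
abbrev braidSign (I : Finset (Fin n × Fin n × ℝ)) (x : RSpace n) : Fin n × Fin n × ℝ → SignType :=
  signVector diffForm (fun t => t.2.2) I x

/-- The sign vectors of all points. -/
abbrev braidSigns (I : Finset (Fin n × Fin n × ℝ)) : Finset (Fin n × Fin n × ℝ → SignType) :=
  signVectors diffForm (fun t => t.2.2) I Set.univ

theorem mem_braidSigns {I : Finset (Fin n × Fin n × ℝ)} {s : Fin n × Fin n × ℝ → SignType} :
    s ∈ braidSigns I ↔ ∃ x, braidSign I x = s := by
  simp [mem_signVectors]

/-- The intersection of the hyperplanes on which `s` vanishes. -/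
def zeroFlat (s : Fin n × Fin n × ℝ → SignType) : AffineSubspace ℝ (RSpace n) :=
  sInf {H | ∃ t, s t = 0 ∧ H = diffHyperplane t.1 t.2.1 t.2.2}

/-- The codimension of the faces with sign vector `s`. -/
def signCodim (s : Fin n × Fin n × ℝ → SignType) : ℕ :=
  n - Module.finrank ℝ (zeroDirection diffForm s)

theorem mem_zeroFlat {s : Fin n × Fin n × ℝ → SignType} {x : RSpace n} :
    x ∈ zeroFlat s ↔ ∀ t, s t = 0 → diffForm t x = t.2.2 := by
  rw [zeroFlat, AffineSubspace.mem_sInf_iff]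
  constructor
  · intro h t ht
    exact h _ ⟨t, ht, rfl⟩
  · rintro h _ ⟨t, ht, rfl⟩
    exact h t ht

variable {I : Finset (Fin n × Fin n × ℝ)}

theorem mem_zeroFlat_braidSign (x : RSpace n) : x ∈ zeroFlat (braidSign I x) :=
  mem_zeroFlat.2 fun _ ht => (signVector_eq_zero_iff.1 ht).2

theorem direction_zeroFlat {s : Fin n × Fin n × ℝ → SignType} {x : RSpace n}
    (hx : x ∈ zeroFlat s) : (zeroFlat s).direction = zeroDirection diffForm s := by
  ext v
  rw [← AffineSubspace.vadd_mem_iff_mem_direction v hx, mem_zeroFlat, mem_zeroDirection]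
  refine forall₂_congr fun t ht => ?_
  rw [vadd_eq_add, map_add, mem_zeroFlat.1 hx t ht, add_eq_right]

theorem zeroFlat_mem_flats (x : RSpace n) :
    zeroFlat (braidSign I x) ∈ flats (tripleArrangement I) := by
  refine ⟨⟨_, ?_, rfl⟩, ⟨x, mem_zeroFlat_braidSign x⟩⟩
  rintro _ ⟨t, ht, rfl⟩
  exact ⟨t, (signVector_eq_zero_iff.1 ht).1, rfl⟩

theorem zeroFlat_le_iff {X : AffineSubspace ℝ (RSpace n)} (hX : X ∈ flats (tripleArrangement I))
    {x : RSpace n} : zeroFlat (braidSign I x) ≤ X ↔ x ∈ X := by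
  refine ⟨fun h => h (mem_zeroFlat_braidSign x), fun hx => ?_⟩
  obtain ⟨⟨B, hB, rfl⟩, -⟩ := hX
  refine le_sInf fun H hH => ?_
  obtain ⟨t, ht, rfl⟩ := hB hH
  have h1 : diffForm t x = t.2.2 := (AffineSubspace.mem_sInf_iff _ _).1 hx _ hH
  exact fun y hy => mem_zeroFlat.1 hy t (signVector_eq_zero_iff.2 ⟨ht, h1⟩)

theorem finite_flats {A : Arrangement n} (hA : A.Finite) : (flats A).Finite := by
  refine (hA.finite_subsets.image sInf).subset ?_
  rintro X ⟨⟨B, hB, rfl⟩, -⟩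
  exact ⟨B, hB, rfl⟩

instance : Finite (IntersectionPoset (tripleArrangement I)) :=
  (finite_flats (I.finite_toSet.image _)).to_subtype

/-- The flat underlying an element of the intersection poset. -/
def toFlat {A : Arrangement n} (X : IntersectionPoset A) : AffineSubspace ℝ (RSpace n) :=
  (OrderDual.ofDual X).1

/-- The codimension of an element of the intersection poset. -/
def flatCodim {A : Arrangement n} (X : IntersectionPoset A) : ℕ :=
  n - Module.finrank ℝ (toFlat X).direction

theorem le_iff_toFlat_le {A : Arrangement n} {X Y : IntersectionPoset A} :
    X ≤ Y ↔ toFlat Y ≤ toFlat X := Iff.rfl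

theorem toFlat_injective {A : Arrangement n} :
    Function.Injective (toFlat : IntersectionPoset A → _) := fun _ _ h => Subtype.ext h

/-- The affine span of the face of `x`, as an element of the intersection poset. -/
def flatOfPoint (I : Finset (Fin n × Fin n × ℝ)) (x : RSpace n) :
    IntersectionPoset (tripleArrangement I) :=
  OrderDual.toDual ⟨_, zeroFlat_mem_flats x⟩

/-- The number of faces whose affine span is the flat `X`. -/
def faceNumber (X : IntersectionPoset (tripleArrangement I)) : ℕ :=
  {s | s ∈ braidSigns I ∧ zeroFlat s = toFlat X}.ncard

theorem finrank_le (D : Submodule ℝ (RSpace n)) : Module.finrank ℝ D ≤ n :=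
  D.finrank_le.trans_eq finrank_euclideanSpace_fin

theorem neg_one_pow_sub {k m : ℕ} (h : k ≤ m) : (-1 : ℤ) ^ (m - k) = (-1) ^ m * (-1) ^ k := by
  obtain ⟨r, rfl⟩ := Nat.exists_eq_add_of_le h
  rw [Nat.add_sub_cancel_left, pow_add, mul_right_comm, ← mul_pow]
  simp

/-- Summing over all faces is summing over the flats that they span. -/
theorem sum_braidSigns_eq {M : Type*} [AddCommMonoid M]
    [Fintype (IntersectionPoset (tripleArrangement I))] (f : ℕ → M)
    (p : IntersectionPoset (tripleArrangement I) → Prop) [DecidablePred p]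
    (q : (Fin n × Fin n × ℝ → SignType) → Prop) [DecidablePred q]
    (hpq : ∀ x, q (braidSign I x) ↔ p (flatOfPoint I x)) :
    ∑ s ∈ braidSigns I with q s, f (signCodim s) =
      ∑ X : IntersectionPoset (tripleArrangement I) with p X,
        faceNumber X • f (flatCodim X) := by
  classical
  let g : (Fin n × Fin n × ℝ → SignType) → IntersectionPoset (tripleArrangement I) := fun s =>
    if h : ∃ x, braidSign I x = s then flatOfPoint I h.choose else flatOfPoint I 0
  have hg : ∀ x, g (braidSign I x) = flatOfPoint I x := by
    intro x
    have h : ∃ y, braidSign I y = braidSign I x := ⟨x, rfl⟩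
    have : g (braidSign I x) = flatOfPoint I h.choose := dif_pos h
    rw [this]
    apply toFlat_injective
    change zeroFlat (braidSign I h.choose) = zeroFlat (braidSign I x)
    rw [h.choose_spec]
  have hmaps : ∀ s ∈ (braidSigns I).filter q,
      g s ∈ (Finset.univ : Finset (IntersectionPoset (tripleArrangement I))).filter p := by
    intro s hs
    obtain ⟨h1, h2⟩ := Finset.mem_filter.1 hs
    obtain ⟨x, rfl⟩ := mem_braidSigns.1 h1
    rw [Finset.mem_filter, hg, ← hpq]
    exact ⟨Finset.mem_univ _, h2⟩
  rw [← Finset.sum_fiberwise_of_maps_to hmaps]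
  refine Finset.sum_congr rfl fun X hX => ?_
  have hX : p X := (Finset.mem_filter.1 hX).2
  have key : ∀ x, g (braidSign I x) = X ↔ zeroFlat (braidSign I x) = toFlat X := by
    intro x
    rw [hg, ← toFlat_injective.eq_iff]; rfl
  have hset : {s | s ∈ braidSigns I ∧ zeroFlat s = toFlat X} =
      ↑(((braidSigns I).filter q).filter fun s => g s = X) := by
    ext s
    simp only [Set.mem_ofPred_eq, Finset.coe_filter, Finset.mem_filter]
    constructor
    · rintro ⟨h1, h2⟩
      obtain ⟨x, rfl⟩ := mem_braidSigns.1 h1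
      refine ⟨⟨h1, ?_⟩, (key x).2 h2⟩
      rw [hpq, ← hg, (key x).2 h2]
      exact hX
    · rintro ⟨⟨h1, -⟩, h2⟩
      obtain ⟨x, rfl⟩ := mem_braidSigns.1 h1
      exact ⟨h1, (key x).1 h2⟩
  rw [faceNumber, hset, Set.ncard_coe_finset, ← Finset.sum_const]
  refine Finset.sum_congr rfl fun s hs => ?_
  obtain ⟨h1, h2⟩ := Finset.mem_filter.1 hs
  obtain ⟨x, rfl⟩ := mem_braidSigns.1 (Finset.mem_filter.1 h1).1
  rw [signCodim, flatCodim, ← (key x).1 h2, direction_zeroFlat (mem_zeroFlat_braidSign x)]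

/-- The Euler relation, as a recursion for the face numbers over the intersection poset. -/
theorem sum_faceNumber_mul [Fintype (IntersectionPoset (tripleArrangement I))]
    (X : IntersectionPoset (tripleArrangement I))
    [DecidablePred fun Y : IntersectionPoset (tripleArrangement I) => X ≤ Y] :
    ∑ Y : IntersectionPoset (tripleArrangement I) with X ≤ Y,
      faceNumber Y • (-1 : ℤ) ^ flatCodim Y = (-1) ^ flatCodim X := by
  classical
  have hX : toFlat X ∈ flats (tripleArrangement I) := (OrderDual.ofDual X).2
  rw [← sum_braidSigns_eq (fun k => (-1 : ℤ) ^ k) (fun Y => X ≤ Y)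
    (fun s => zeroFlat s ≤ toFlat X) fun x => Iff.rfl]
  have h1 : (braidSigns I).filter (fun s => zeroFlat s ≤ toFlat X) =
      signVectors diffForm (fun t => t.2.2) I (toFlat X : Set (RSpace n)) := by
    ext s
    rw [Finset.mem_filter, mem_braidSigns, mem_signVectors]
    constructor
    · rintro ⟨⟨x, rfl⟩, h⟩
      exact ⟨x, (zeroFlat_le_iff hX).1 h, rfl⟩
    · rintro ⟨x, hx, rfl⟩
      exact ⟨⟨x, rfl⟩, (zeroFlat_le_iff hX).2 hx⟩
  rw [h1, flatCodim, neg_one_pow_sub (finrank_le _),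
    ← sum_signVectors_neg_one_pow (φ := diffForm) (c := fun t => t.2.2) (toFlat X) hX.2 I,
    Finset.mul_sum]
  refine Finset.sum_congr rfl fun s hs => ?_
  obtain ⟨x, hx, rfl⟩ := mem_signVectors.1 hs
  have h2 : zeroDirection diffForm (braidSign I x) ≤ (toFlat X).direction := by
    rw [← direction_zeroFlat (mem_zeroFlat_braidSign x)]
    exact AffineSubspace.direction_le ((zeroFlat_le_iff hX).2 hx)
  rw [signCodim, neg_one_pow_sub (finrank_le _), inf_eq_right.2 h2]

/-- Some hyperplane through the smaller flat `Y` does not contain the larger flat `X`; it cuts `X`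
in a flat of codimension one more, which lies between the two. -/
theorem exists_between_flatCodim {X Y : IntersectionPoset (tripleArrangement I)} (h : X < Y) :
    ∃ Z, X < Z ∧ Z ≤ Y ∧ flatCodim Z = flatCodim X + 1 := by
  obtain ⟨⟨C, hC, hYC⟩, ⟨z, hz⟩⟩ := (OrderDual.ofDual Y).2
  obtain ⟨⟨B, hB, hXB⟩, hXne⟩ := (OrderDual.ofDual X).2
  change toFlat Y = sInf C at hYC
  change toFlat X = sInf B at hXB
  have hz : z ∈ toFlat Y := hz
  have hnot : ¬ toFlat X ≤ toFlat Y := fun h' => h.not_ge h'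
  have hle : toFlat Y ≤ toFlat X := h.le
  obtain ⟨H, hH, hXH⟩ : ∃ H ∈ C, ¬ toFlat X ≤ H := by
    by_contra! hcon
    exact hnot (hYC ▸ le_sInf hcon)
  obtain ⟨t, ht, rfl⟩ := hC hH
  have hYH : toFlat Y ≤ diffHyperplane t.1 t.2.1 t.2.2 := hYC ▸ sInf_le hH
  have hins : sInf (insert (diffHyperplane t.1 t.2.1 t.2.2) B) =
      diffHyperplane t.1 t.2.1 t.2.2 ⊓ toFlat X := by rw [sInf_insert, hXB]
  have hzmem : z ∈ diffHyperplane t.1 t.2.1 t.2.2 ⊓ toFlat X := ⟨hYH hz, hle hz⟩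
  let Z : IntersectionPoset (tripleArrangement I) :=
    OrderDual.toDual ⟨diffHyperplane t.1 t.2.1 t.2.2 ⊓ toFlat X,
      ⟨_, Set.insert_subset (hC hH) hB, hins.symm⟩, ⟨z, hzmem⟩⟩
  have hZ : toFlat Z = diffHyperplane t.1 t.2.1 t.2.2 ⊓ toFlat X := rfl
  refine ⟨Z, lt_of_le_not_ge (le_iff_toFlat_le.2 (hZ ▸ inf_le_right)) ?_,
    le_iff_toFlat_le.2 (hZ ▸ le_inf hYH hle), ?_⟩
  · intro h'
    exact hXH ((le_iff_toFlat_le.1 h').trans inf_le_left)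
  · obtain ⟨w, hw, hwt⟩ := SetLike.not_le_iff_exists.1 hXH
    have hdir : (toFlat Z).direction = (toFlat X).direction ⊓ LinearMap.ker (diffForm t) := by
      ext v
      have hzt : diffForm t z = t.2.2 := hzmem.1
      rw [Submodule.mem_inf, ← AffineSubspace.vadd_mem_iff_mem_direction v hzmem.2,
        ← AffineSubspace.vadd_mem_iff_mem_direction v (hZ ▸ hzmem), hZ, AffineSubspace.mem_inf_iff,
        and_comm, mem_diffHyperplane, vadd_eq_add, map_add, hzt, add_eq_right, LinearMap.mem_ker]
    have hu : w - z ∈ (toFlat X).direction := AffineSubspace.vsub_mem_direction hw hzmem.2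
    have hφ : diffForm t (w - z) ≠ 0 := by
      rw [map_sub, sub_ne_zero]
      intro h'
      exact hwt (mem_diffHyperplane.2 (h'.trans hzmem.1))
    have h1 := finrank_inf_ker_add_one hu hφ
    have h2 := finrank_le (toFlat X).direction
    rw [flatCodim, flatCodim, hdir]
    omega

theorem flatCodim_of_covBy {X Y : IntersectionPoset (tripleArrangement I)} (h : X ⋖ Y) :
    flatCodim Y = flatCodim X + 1 := by
  obtain ⟨Z, h1, h2, h3⟩ := exists_between_flatCodim h.lt
  rcases h2.eq_or_lt with rfl | h4
  · exact h3
  · exact absurd h4 (h.2 h1)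

theorem flatCodim_of_isMin {X : IntersectionPoset (tripleArrangement I)} (h : IsMin X) :
    flatCodim X = 0 := by
  let Z : IntersectionPoset (tripleArrangement I) :=
    OrderDual.toDual ⟨⊤, ⟨∅, Set.empty_subset _, sInf_empty.symm⟩, ⟨0, trivial⟩⟩
  have h1 : toFlat Z = ⊤ := rfl
  have h2 : toFlat Z ≤ toFlat X := h (show toFlat X ≤ toFlat Z from h1 ▸ le_top)
  rw [flatCodim, show toFlat X = ⊤ from top_le_iff.1 (h1 ▸ h2), AffineSubspace.direction_top, finrank_top,
    finrank_euclideanSpace_fin, Nat.sub_self]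

variable {m : ℕ} {J : Finset (Fin m × Fin m × ℝ)}

/-- Codimension is determined by the order, since it grows by one along every cover. -/
theorem flatCodim_orderIso
    (e : IntersectionPoset (tripleArrangement I) ≃o IntersectionPoset (tripleArrangement J))
    (X : IntersectionPoset (tripleArrangement I)) : flatCodim (e X) = flatCodim X := by
  induction X using (wellFounded_lt (α := IntersectionPoset (tripleArrangement I))).induction with
  | _ X ih =>
    by_cases hX : IsMin X
    · rw [flatCodim_of_isMin hX, flatCodim_of_isMin (e.isMin_apply.2 hX)]
    · obtain ⟨W, hW⟩ := not_isMin_iff.1 hX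
      obtain ⟨Y, -, hY⟩ := exists_le_covBy_of_lt hW
      rw [flatCodim_of_covBy hY, flatCodim_of_covBy ((apply_covBy_apply_iff e).2 hY), ih Y hY.lt]

/-- The number of faces that span a given flat depends only on the intersection poset. -/
theorem faceNumber_orderIso
    (e : IntersectionPoset (tripleArrangement I) ≃o IntersectionPoset (tripleArrangement J))
    (X : IntersectionPoset (tripleArrangement I)) : faceNumber (e X) = faceNumber X := by
  classical
  let _ := Fintype.ofFinite (IntersectionPoset (tripleArrangement I))
  let _ := Fintype.ofFinite (IntersectionPoset (tripleArrangement J))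
  induction X using (wellFounded_gt (α := IntersectionPoset (tripleArrangement I))).induction with
  | _ X ih =>
    have h1 := sum_faceNumber_mul X
    have h2 := sum_faceNumber_mul (e X)
    have h3 : ∑ Y : IntersectionPoset (tripleArrangement J) with e X ≤ Y,
        faceNumber Y • (-1 : ℤ) ^ flatCodim Y =
        ∑ Y : IntersectionPoset (tripleArrangement I) with X ≤ Y,
        faceNumber (e Y) • (-1 : ℤ) ^ flatCodim Y := by
      symm
      refine Finset.sum_equiv e.toEquiv (fun Y => by simp) fun Y _ => ?_
      simp [flatCodim_orderIso]
    rw [h3, flatCodim_orderIso, ← h1] at h2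
    have hmem : X ∈ (Finset.univ : Finset (IntersectionPoset (tripleArrangement I))).filter
      (fun Y => X ≤ Y) := by simp
    rw [← Finset.add_sum_erase _ _ hmem, ← Finset.add_sum_erase _ _ hmem] at h2
    have h4 : ∀ Y ∈ ((Finset.univ : Finset (IntersectionPoset (tripleArrangement I))).filter
        (fun Y => X ≤ Y)).erase X, faceNumber (e Y) • (-1 : ℤ) ^ flatCodim Y =
        faceNumber Y • (-1 : ℤ) ^ flatCodim Y := by
      intro Y hY
      rw [Finset.mem_erase, Finset.mem_filter] at hY
      rw [ih Y (lt_of_le_of_ne hY.2.2 hY.1.symm)]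
    rw [Finset.sum_congr rfl h4, add_left_inj, nsmul_eq_mul, nsmul_eq_mul] at h2
    exact_mod_cast mul_right_cancel₀ (pow_ne_zero _ (by norm_num)) h2

/-- The face polynomial, counting all faces by codimension, depends only on the intersection
poset. -/
theorem sum_X_pow_signCodim_eq
    (e : IntersectionPoset (tripleArrangement I) ≃o IntersectionPoset (tripleArrangement J)) :
    ∑ s ∈ braidSigns I, (Polynomial.X : ℚ[X]) ^ signCodim s =
      ∑ s ∈ braidSigns J, Polynomial.X ^ signCodim s := by
  classical
  let _ := Fintype.ofFinite (IntersectionPoset (tripleArrangement I))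
  let _ := Fintype.ofFinite (IntersectionPoset (tripleArrangement J))
  have h1 := sum_braidSigns_eq (I := I) (fun k => (Polynomial.X : ℚ[X]) ^ k)
    (fun _ => True) (fun _ => True) fun _ => Iff.rfl
  have h2 := sum_braidSigns_eq (I := J) (fun k => (Polynomial.X : ℚ[X]) ^ k)
    (fun _ => True) (fun _ => True) fun _ => Iff.rfl
  simp only [Finset.filter_true] at h1 h2
  rw [h1, h2, ← e.toEquiv.sum_comp]
  refine Finset.sum_congr rfl fun X _ => ?_
  rw [show e.toEquiv X = e X from rfl, faceNumber_orderIso, flatCodim_orderIso]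

end IntersectionPoset

/-! ### Blocks of a face and gluing -/

section Gluing

variable {n : ℕ}

/-- The triples `(i, j, c)` with `i < j` in `S` and `c ∈ a i j`, which index the hyperplanes
`x_i - x_j = c` of the subarrangement on `S`. -/
def triples (a : Fin n → Fin n → Finset ℝ) (S : Finset (Fin n)) : Finset (Fin n × Fin n × ℝ) :=
  ((S ×ˢ S).filter fun p => p.1 < p.2).biUnion fun p => (a p.1 p.2).image fun c => (p.1, p.2, c)

variable {a : Fin n → Fin n → Finset ℝ} {S T : Finset (Fin n)}

theorem mem_triples {t : Fin n × Fin n × ℝ} :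
    t ∈ triples a S ↔ t.1 ∈ S ∧ t.2.1 ∈ S ∧ t.1 < t.2.1 ∧ t.2.2 ∈ a t.1 t.2.1 := by
  obtain ⟨i, j, c⟩ := t
  simp only [triples, Finset.mem_biUnion, Finset.mem_filter, Finset.mem_product, Finset.mem_image,
    Prod.mk.injEq, Prod.exists]
  constructor
  · rintro ⟨i', j', ⟨⟨h1, h2⟩, h3⟩, c', hc, rfl, rfl, rfl⟩
    exact ⟨h1, h2, h3, hc⟩
  · rintro ⟨h1, h2, h3, h4⟩
    exact ⟨i, j, ⟨⟨h1, h2⟩, h3⟩, c, h4, rfl, rfl, rfl⟩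

/-- The sign vector of `x` for the subarrangement on `S`. -/
abbrev signOn (a : Fin n → Fin n → Finset ℝ) (S : Finset (Fin n)) (x : RSpace n) :
    Fin n × Fin n × ℝ → SignType :=
  braidSign (triples a S) x

theorem signOn_congr {x y : RSpace n} (h : ∀ i ∈ S, ∀ j ∈ S, x i - x j = y i - y j) :
    signOn a S x = signOn a S y := by
  rw [signVector_eq_iff]
  intro t ht
  have ht := mem_triples.1 ht
  rw [diffForm_apply, diffForm_apply, h _ ht.1 _ ht.2.1]

/-- The difference `y_i - y_j` is bounded below on the face with sign vector `s`. This is a total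
preorder on `S` (`dominates_total`), whose equivalence classes are the blocks of the face. -/
def Dominates (a : Fin n → Fin n → Finset ℝ) (S : Finset (Fin n))
    (s : Fin n × Fin n × ℝ → SignType) (i j : Fin n) : Prop :=
  ∃ r : ℝ, ∀ y, signOn a S y = s → r ≤ y i - y j

theorem dominates_refl (s : Fin n × Fin n × ℝ → SignType) (i : Fin n) : Dominates a S s i i :=
  ⟨0, fun y _ => by simp⟩

theorem Dominates.trans {s : Fin n × Fin n × ℝ → SignType} {i j k : Fin n}
    (h1 : Dominates a S s i j) (h2 : Dominates a S s j k) : Dominates a S s i k := by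
  obtain ⟨r, hr⟩ := h1
  obtain ⟨q, hq⟩ := h2
  exact ⟨r + q, fun y hy => by linarith [hr y hy, hq y hy]⟩

/-- Totality holds because every pair of coordinates is compared by at least one hyperplane. -/
theorem dominates_total (ha : ∀ i j, i < j → (a i j).Nonempty) (x : RSpace n) {i j : Fin n}
    (hi : i ∈ S) (hj : j ∈ S) :
    Dominates a S (signOn a S x) i j ∨ Dominates a S (signOn a S x) j i := by
  wlog hij : i < j generalizing i j
  · rcases (not_lt.1 hij).eq_or_lt with rfl | h
    · exact Or.inl (dominates_refl _ _)
    · exact (this hj hi h).symm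
  obtain ⟨c, hc⟩ := ha i j hij
  have ht : (i, j, c) ∈ triples a S := mem_triples.2 ⟨hi, hj, hij, hc⟩
  rcases lt_or_ge (x i - x j - c) 0 with h | h
  · refine Or.inr ⟨-c, fun y hy => ?_⟩
    have h1 : SignType.sign (y i - y j - c) = SignType.sign (x i - x j - c) :=
      signVector_eq_iff.1 hy _ ht
    rw [sign_neg h, sign_eq_neg_one_iff] at h1
    linarith
  · refine Or.inl ⟨c, fun y hy => ?_⟩
    have h1 : SignType.sign (y i - y j - c) = SignType.sign (x i - x j - c) :=
      signVector_eq_iff.1 hy _ ht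
    by_contra hcon
    rw [sign_neg (show y i - y j - c < 0 by linarith), eq_comm, sign_eq_neg_one_iff] at h1
    linarith

open Classical in
/-- The elements of `S` whose block is that of `i` or a higher one. -/
def upSet (a : Fin n → Fin n → Finset ℝ) (S : Finset (Fin n))
    (s : Fin n × Fin n × ℝ → SignType) (i : Fin n) : Finset (Fin n) :=
  S.filter fun j => Dominates a S s j i

theorem mem_upSet {s : Fin n × Fin n × ℝ → SignType} {i j : Fin n} :
    j ∈ upSet a S s i ↔ j ∈ S ∧ Dominates a S s j i := by
  simp [upSet]

/-- The number of blocks of the face with sign vector `s`, counted through the up-sets that they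
generate. -/
def signLevel (a : Fin n → Fin n → Finset ℝ) (S : Finset (Fin n))
    (s : Fin n × Fin n × ℝ → SignType) : ℕ :=
  (S.image (upSet a S s)).card

theorem signLevel_pos (hS : S.Nonempty) (s : Fin n × Fin n × ℝ → SignType) :
    1 ≤ signLevel a S s :=
  Finset.card_pos.2 (hS.image _)

theorem signLevel_le (s : Fin n × Fin n × ℝ → SignType) : signLevel a S s ≤ S.card :=
  Finset.card_image_le

theorem signLevel_eq_one_iff {s : Fin n × Fin n × ℝ → SignType} :
    signLevel a S s = 1 ↔ S.Nonempty ∧ ∀ i ∈ S, ∀ j ∈ S, Dominates a S s i j := by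
  constructor
  · intro h
    obtain ⟨U, hU⟩ := Finset.card_eq_one.1 h
    refine ⟨?_, fun i hi j hj => ?_⟩
    · exact (Finset.image_nonempty (f := upSet a S s)).1 (hU ▸ Finset.singleton_nonempty _)
    · have h1 : ∀ k ∈ S, upSet a S s k = U := fun k hk =>
        Finset.mem_singleton.1 (hU ▸ Finset.mem_image_of_mem _ hk)
      have h2 : i ∈ upSet a S s i := mem_upSet.2 ⟨hi, dominates_refl _ _⟩
      rw [h1 i hi, ← h1 j hj] at h2
      exact (mem_upSet.1 h2).2
  · rintro ⟨⟨k, hk⟩, h⟩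
    refine Finset.card_eq_one.2 ⟨S, ?_⟩
    have h1 : ∀ i ∈ S, upSet a S s i = S := fun i hi => by
      ext j
      rw [mem_upSet]
      exact ⟨And.left, fun hj => ⟨hj, h j hj i hi⟩⟩
    ext U
    rw [Finset.mem_image, Finset.mem_singleton]
    constructor
    · rintro ⟨i, hi, rfl⟩
      exact h1 i hi
    · rintro rfl
      exact ⟨k, hk, h1 k hk⟩

/-- All coordinates in `T` lie above all coordinates in `S \ T`, for every hyperplane that compares
them. -/
def IsAbove (a : Fin n → Fin n → Finset ℝ) (S T : Finset (Fin n)) (z : RSpace n) : Prop :=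
  ∀ i ∈ T, ∀ j ∈ S \ T, (i < j → ∀ c ∈ a i j, c < z i - z j) ∧
    (j < i → ∀ c ∈ a j i, z j - z i < c)

/-- The sign vector on `S` that agrees with `u` on `T`, with `v` on `S \ T`, and places `T` above
`S \ T`. -/
def glue (a : Fin n → Fin n → Finset ℝ) (S T : Finset (Fin n))
    (u v : Fin n × Fin n × ℝ → SignType) : Fin n × Fin n × ℝ → SignType := fun t =>
  if t.1 ∈ T then if t.2.1 ∈ T then u t else 1
  else if t.2.1 ∈ T then if t ∈ triples a S then -1 else 1 else v t

theorem glue_of_mem {u v : Fin n × Fin n × ℝ → SignType} {t : Fin n × Fin n × ℝ} (h1 : t.1 ∈ T)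
    (h2 : t.2.1 ∈ T) : glue a S T u v t = u t := by simp [glue, h1, h2]

theorem glue_of_notMem {u v : Fin n × Fin n × ℝ → SignType} {t : Fin n × Fin n × ℝ}
    (h1 : t.1 ∉ T) (h2 : t.2.1 ∉ T) : glue a S T u v t = v t := by simp [glue, h1, h2]

theorem signOn_subset (hT : T ⊆ S) {t : Fin n × Fin n × ℝ} (h1 : t.1 ∈ T) (h2 : t.2.1 ∈ T)
    (z : RSpace n) : signOn a S z t = signOn a T z t := by
  have h : t ∈ triples a S ↔ t ∈ triples a T := by
    simp only [mem_triples, h1, h2, hT h1, hT h2]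
  simp [signVector, h]

theorem signOn_sdiff {t : Fin n × Fin n × ℝ} (h1 : t.1 ∉ T) (h2 : t.2.1 ∉ T)
    (z : RSpace n) : signOn a S z t = signOn a (S \ T) z t := by
  have h : t ∈ triples a S ↔ t ∈ triples a (S \ T) := by
    simp [mem_triples, h1, h2]
  simp [signVector, h]

theorem signOn_of_not_mem {t : Fin n × Fin n × ℝ} (h : ¬ (t.1 ∈ S ∧ t.2.1 ∈ S)) (z : RSpace n) :
    signOn a S z t = 1 :=
  signVector_of_notMem (fun h' => h ⟨(mem_triples.1 h').1, (mem_triples.1 h').2.1⟩) z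

theorem signOn_of_mem {t : Fin n × Fin n × ℝ} (h : t ∈ triples a S) (z : RSpace n) :
    signOn a S z t = SignType.sign (z t.1 - z t.2.1 - t.2.2) :=
  signVector_of_mem h z

/-- The face with the glued sign vector, described by its restrictions to `T` and `S \ T`. -/
theorem signOn_eq_glue_iff (hT : T ⊆ S) {x y z : RSpace n} :
    signOn a S z = glue a S T (signOn a T x) (signOn a (S \ T) y) ↔
      signOn a T z = signOn a T x ∧ signOn a (S \ T) z = signOn a (S \ T) y ∧ IsAbove a S T z := by
  constructor
  · intro h
    refine ⟨?_, ?_, ?_⟩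
    · funext t
      by_cases ht : t.1 ∈ T ∧ t.2.1 ∈ T
      · rw [← signOn_subset hT ht.1 ht.2, h, glue_of_mem ht.1 ht.2]
      · rw [signOn_of_not_mem ht, signOn_of_not_mem ht]
    · funext t
      by_cases ht : t.1 ∈ S \ T ∧ t.2.1 ∈ S \ T
      · have h1 := (Finset.mem_sdiff.1 ht.1).2
        have h2 := (Finset.mem_sdiff.1 ht.2).2
        rw [← signOn_sdiff h1 h2, h, glue_of_notMem h1 h2]
      · rw [signOn_of_not_mem ht, signOn_of_not_mem ht]
    · intro i hi j hj
      obtain ⟨hjS, hjT⟩ := Finset.mem_sdiff.1 hj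
      refine ⟨fun hij c hc => ?_, fun hji c hc => ?_⟩
      · have ht : (i, j, c) ∈ triples a S := mem_triples.2 ⟨hT hi, hjS, hij, hc⟩
        have h1 := congrFun h (i, j, c)
        rw [signOn_of_mem ht] at h1
        simp only [glue, hi, hjT, if_true, if_false, sign_eq_one_iff] at h1
        linarith
      · have ht : (j, i, c) ∈ triples a S := mem_triples.2 ⟨hjS, hT hi, hji, hc⟩
        have h1 := congrFun h (j, i, c)
        rw [signOn_of_mem ht] at h1
        simp only [glue, hi, hjT, ht, if_true, if_false, sign_eq_neg_one_iff] at h1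
        linarith
  · rintro ⟨h1, h2, h3⟩
    funext t
    by_cases ht1 : t.1 ∈ T <;> by_cases ht2 : t.2.1 ∈ T
    · rw [glue_of_mem ht1 ht2, ← h1, signOn_subset hT ht1 ht2]
    · simp only [glue, ht1, ht2, if_true, if_false]
      by_cases ht : t ∈ triples a S
      · obtain ⟨-, h5, h6, h7⟩ := mem_triples.1 ht
        rw [signOn_of_mem ht, sign_eq_one_iff]
        linarith [(h3 _ ht1 _ (Finset.mem_sdiff.2 ⟨h5, ht2⟩)).1 h6 _ h7]
      · exact signVector_of_notMem ht z
    · simp only [glue, ht1, ht2, if_true, if_false]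
      by_cases ht : t ∈ triples a S
      · obtain ⟨h5, -, h6, h7⟩ := mem_triples.1 ht
        rw [signOn_of_mem ht, if_pos ht, sign_eq_neg_one_iff]
        linarith [(h3 _ ht2 _ (Finset.mem_sdiff.2 ⟨h5, ht1⟩)).2 h6 _ h7]
      · rw [if_neg ht]
        exact signVector_of_notMem ht z
    · rw [glue_of_notMem ht1 ht2, ← h2, signOn_sdiff ht1 ht2]

/-- The point with the coordinates of `x`, shifted up by `r`, on `T`, and those of `y` off `T`. -/
def shiftOn (T : Finset (Fin n)) (r : ℝ) (x y : RSpace n) : RSpace n :=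
  WithLp.toLp 2 fun i => if i ∈ T then x i + r else y i

theorem shiftOn_of_mem {i : Fin n} (hi : i ∈ T) (r : ℝ) (x y : RSpace n) :
    shiftOn T r x y i = x i + r := by simp [shiftOn, hi]

theorem shiftOn_of_notMem {i : Fin n} (hi : i ∉ T) (r : ℝ) (x y : RSpace n) :
    shiftOn T r x y i = y i := by simp [shiftOn, hi]

open Filter in
/-- Every glued sign vector is realized, by shifting the coordinates in `T` up far enough. -/
theorem eventually_signOn_shiftOn (hT : T ⊆ S) (x y : RSpace n) :
    ∀ᶠ r in atTop,
      signOn a S (shiftOn T r x y) = glue a S T (signOn a T x) (signOn a (S \ T) y) := by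
  have h : ∀ᶠ r in atTop, IsAbove a S T (shiftOn T r x y) := by
    simp only [IsAbove]
    rw [Finset.eventually_all]
    intro i hi
    rw [Finset.eventually_all]
    intro j hj
    simp only [shiftOn_of_mem hi, shiftOn_of_notMem (Finset.mem_sdiff.1 hj).2]
    refine Filter.Eventually.and ?_ ?_
    · refine Filter.Eventually.mono (p := fun r => ∀ c ∈ a i j, c < x i + r - y j) ?_
        fun r h _ => h
      rw [Finset.eventually_all]
      intro c _
      filter_upwards [eventually_gt_atTop (c - x i + y j)] with r hr
      linarith
    · refine Filter.Eventually.mono (p := fun r => ∀ c ∈ a j i, y j - (x i + r) < c) ?_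
        fun r h _ => h
      rw [Finset.eventually_all]
      intro c _
      filter_upwards [eventually_gt_atTop (y j - x i - c)] with r hr
      linarith
  filter_upwards [h] with r hr
  refine (signOn_eq_glue_iff hT).2 ⟨signOn_congr fun i hi j hj => ?_,
    signOn_congr fun i hi j hj => ?_, hr⟩
  · rw [shiftOn_of_mem hi, shiftOn_of_mem hj]; ring
  · rw [shiftOn_of_notMem (Finset.mem_sdiff.1 hi).2, shiftOn_of_notMem (Finset.mem_sdiff.1 hj).2]

theorem dominates_glue_left (hT : T ⊆ S) (x y : RSpace n) {i j : Fin n} (hi : i ∈ T) (hj : j ∈ T) :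
    Dominates a S (glue a S T (signOn a T x) (signOn a (S \ T) y)) i j ↔
      Dominates a T (signOn a T x) i j := by
  constructor
  · rintro ⟨r, hr⟩
    refine ⟨r, fun z hz => ?_⟩
    obtain ⟨q, hq⟩ := (eventually_signOn_shiftOn (a := a) hT z y).exists
    have := hr _ (hz ▸ hq)
    rw [shiftOn_of_mem hi, shiftOn_of_mem hj] at this
    linarith
  · rintro ⟨r, hr⟩
    exact ⟨r, fun z hz => hr z ((signOn_eq_glue_iff hT).1 hz).1⟩

theorem dominates_glue_right (hT : T ⊆ S) (x y : RSpace n) {i j : Fin n} (hi : i ∉ T)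
    (hj : j ∉ T) :
    Dominates a S (glue a S T (signOn a T x) (signOn a (S \ T) y)) i j ↔
      Dominates a (S \ T) (signOn a (S \ T) y) i j := by
  constructor
  · rintro ⟨r, hr⟩
    refine ⟨r, fun z hz => ?_⟩
    obtain ⟨q, hq⟩ := (eventually_signOn_shiftOn (a := a) hT x z).exists
    have := hr _ (hz ▸ hq)
    rwa [shiftOn_of_notMem hi, shiftOn_of_notMem hj] at this
  · rintro ⟨r, hr⟩
    exact ⟨r, fun z hz => hr z ((signOn_eq_glue_iff hT).1 hz).2.1⟩

theorem not_dominates_glue (hT : T ⊆ S) (x y : RSpace n) {i j : Fin n} (hi : i ∈ T)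
    (hj : j ∉ T) :
    ¬ Dominates a S (glue a S T (signOn a T x) (signOn a (S \ T) y)) j i := by
  rintro ⟨r, hr⟩
  obtain ⟨q, hq, hq2⟩ := ((eventually_signOn_shiftOn (a := a) hT x y).and
    (Filter.eventually_gt_atTop (y j - x i - r))).exists
  have := hr _ hq
  rw [shiftOn_of_mem hi, shiftOn_of_notMem hj] at this
  linarith

theorem exists_signOn_eq_glue (hT : T ⊆ S) (x y : RSpace n) :
    ∃ z, signOn a S z = glue a S T (signOn a T x) (signOn a (S \ T) y) :=
  let ⟨_, h⟩ := (eventually_signOn_shiftOn (a := a) hT x y).exists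
  ⟨_, h⟩

theorem signLevel_glue (ha : ∀ i j, i < j → (a i j).Nonempty) (hT : T ⊆ S) (x y : RSpace n) :
    signLevel a S (glue a S T (signOn a T x) (signOn a (S \ T) y)) =
      signLevel a T (signOn a T x) + signLevel a (S \ T) (signOn a (S \ T) y) := by
  set s := glue a S T (signOn a T x) (signOn a (S \ T) y) with hs
  obtain ⟨z, hz⟩ := exists_signOn_eq_glue (a := a) hT x y
  have h1 : ∀ i ∈ T, upSet a S s i = upSet a T (signOn a T x) i := by
    intro i hi
    ext j
    rw [mem_upSet, mem_upSet]
    by_cases hj : j ∈ T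
    · simp only [hj, hT hj, true_and, hs, dominates_glue_left hT x y hj hi]
    · simp only [hj, false_and, iff_false, not_and]
      exact fun _ => not_dominates_glue hT x y hi hj
  have h2 : ∀ i ∈ S \ T, upSet a S s i = T ∪ upSet a (S \ T) (signOn a (S \ T) y) i := by
    intro i hi
    obtain ⟨hiS, hiT⟩ := Finset.mem_sdiff.1 hi
    ext j
    rw [Finset.mem_union, mem_upSet, mem_upSet]
    by_cases hj : j ∈ T
    · simp only [hj, hT hj, true_and, true_or, iff_true]
      have h := dominates_total ha z hiS (hT hj)
      rw [hz] at h
      exact h.resolve_left (not_dominates_glue hT x y hj hiT)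
    · simp only [hj, false_or, Finset.mem_sdiff, not_false_eq_true, and_true, hs,
        dominates_glue_right hT x y hj hiT]
  have h3 : S.image (upSet a S s) = T.image (upSet a T (signOn a T x)) ∪
      ((S \ T).image (upSet a (S \ T) (signOn a (S \ T) y))).image (T ∪ ·) := by
    have h4 : S.image (upSet a S s) = T.image (upSet a S s) ∪ (S \ T).image (upSet a S s) := by
      rw [← Finset.image_union, Finset.union_sdiff_of_subset hT]
    rw [h4, Finset.image_congr (fun i hi => h1 i hi), Finset.image_congr (fun i hi => h2 i hi),
      Finset.image_image]
    rfl
  rw [signLevel, h3, Finset.card_union_of_disjoint,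
    Finset.card_image_of_injOn (s := Finset.image _ _)]
  · rfl
  · intro U hU W hW hUW
    have key : ∀ U ∈ (S \ T).image (upSet a (S \ T) (signOn a (S \ T) y)), Disjoint T U := by
      intro U hU
      obtain ⟨i, -, rfl⟩ := Finset.mem_image.1 hU
      exact Finset.disjoint_sdiff.mono_right fun j hj => (mem_upSet.1 hj).1
    have hU := key U hU
    have hW := key W hW
    have h4 : (T ∪ U) \ T = (T ∪ W) \ T := congrArg (· \ T) hUW
    rwa [Finset.union_sdiff_cancel_left hU, Finset.union_sdiff_cancel_left hW] at h4
  · rw [Finset.disjoint_left]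
    intro U hU hU2
    obtain ⟨i, -, rfl⟩ := Finset.mem_image.1 hU
    obtain ⟨W, hW, hW2⟩ := Finset.mem_image.1 hU2
    obtain ⟨j, hj, rfl⟩ := Finset.mem_image.1 hW
    have h4 : j ∈ upSet a T (signOn a T x) i := by
      rw [← hW2]
      exact Finset.mem_union_right _ (mem_upSet.2 ⟨hj, dominates_refl _ _⟩)
    exact (Finset.mem_sdiff.1 hj).2 (mem_upSet.1 h4).1

/-- The equations `x_i = x_j` on `T` and those on `S \ T` involve different coordinates, so the two
zero directions are transversal. -/
theorem signCodim_glue (x y : RSpace n) :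
    signCodim (glue a S T (signOn a T x) (signOn a (S \ T) y)) =
      signCodim (signOn a T x) + signCodim (signOn a (S \ T) y) := by
  set u := signOn a T x with hu
  set v := signOn a (S \ T) y with hv
  have hu0 : ∀ t, u t = 0 → t.1 ∈ T ∧ t.2.1 ∈ T := fun t ht =>
    have h := mem_triples.1 (signVector_eq_zero_iff.1 ht).1
    ⟨h.1, h.2.1⟩
  have hv0 : ∀ t, v t = 0 → t.1 ∉ T ∧ t.2.1 ∉ T := fun t ht =>
    have h := mem_triples.1 (signVector_eq_zero_iff.1 ht).1
    ⟨(Finset.mem_sdiff.1 h.1).2, (Finset.mem_sdiff.1 h.2.1).2⟩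
  have hinf : zeroDirection diffForm (glue a S T u v) =
      zeroDirection diffForm u ⊓ zeroDirection diffForm v := by
    ext w
    simp only [Submodule.mem_inf, mem_zeroDirection]
    constructor
    · intro h
      refine ⟨fun t ht => h t ?_, fun t ht => h t ?_⟩
      · rwa [glue_of_mem (hu0 t ht).1 (hu0 t ht).2]
      · rwa [glue_of_notMem (hv0 t ht).1 (hv0 t ht).2]
    · rintro ⟨h1, h2⟩ t ht
      by_cases ht1 : t.1 ∈ T <;> by_cases ht2 : t.2.1 ∈ T
      · rw [glue_of_mem ht1 ht2] at ht
        exact h1 t ht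
      · simp [glue, ht1, ht2] at ht
      · simp only [glue, ht1, ht2, if_true, if_false] at ht
        split_ifs at ht
      · rw [glue_of_notMem ht1 ht2] at ht
        exact h2 t ht
  have hsup : zeroDirection diffForm u ⊔ zeroDirection diffForm v = ⊤ := by
    rw [eq_top_iff]
    intro w _
    have hw : w = shiftOn T 0 0 w + shiftOn T 0 w 0 := by
      ext i
      by_cases hi : i ∈ T
      · simp [shiftOn_of_mem hi]
      · simp [shiftOn_of_notMem hi]
    rw [hw]
    refine Submodule.add_mem_sup ?_ ?_
    · rw [mem_zeroDirection]
      intro t ht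
      rw [diffForm_apply, shiftOn_of_mem (hu0 t ht).1, shiftOn_of_mem (hu0 t ht).2]
      simp
    · rw [mem_zeroDirection]
      intro t ht
      rw [diffForm_apply, shiftOn_of_notMem (hv0 t ht).1, shiftOn_of_notMem (hv0 t ht).2]
      simp
  have h := Submodule.finrank_sup_add_finrank_inf_eq (zeroDirection diffForm u)
    (zeroDirection diffForm v)
  rw [hsup, finrank_top, finrank_euclideanSpace_fin, ← hinf] at h
  have h1 := finrank_le (zeroDirection diffForm u)
  have h2 := finrank_le (zeroDirection diffForm v)
  rw [signCodim, signCodim, signCodim]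
  omega

open Classical in
/-- The highest block of the face with sign vector `s`. -/
def topBlock (a : Fin n → Fin n → Finset ℝ) (S : Finset (Fin n))
    (s : Fin n × Fin n × ℝ → SignType) : Finset (Fin n) :=
  S.filter fun i => ∀ j ∈ S, Dominates a S s i j

theorem mem_topBlock {s : Fin n × Fin n × ℝ → SignType} {i : Fin n} :
    i ∈ topBlock a S s ↔ i ∈ S ∧ ∀ j ∈ S, Dominates a S s i j := by
  simp [topBlock]

theorem topBlock_subset (s : Fin n × Fin n × ℝ → SignType) : topBlock a S s ⊆ S :=
  fun _ hi => (mem_topBlock.1 hi).1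

theorem topBlock_nonempty (ha : ∀ i j, i < j → (a i j).Nonempty) (hS : S.Nonempty)
    (x : RSpace n) : (topBlock a S (signOn a S x)).Nonempty := by
  -- an element whose up-set is smallest
  obtain ⟨i, hi, hmin⟩ := Finset.exists_min_image S
    (fun i => (upSet a S (signOn a S x) i).card) hS
  refine ⟨i, mem_topBlock.2 ⟨hi, fun j hj => ?_⟩⟩
  by_contra hcon
  have hji := (dominates_total ha x hi hj).resolve_left hcon
  refine absurd (hmin j hj) (not_le.2 (Finset.card_lt_card ⟨fun k hk => ?_, fun h => ?_⟩))
  · rw [mem_upSet] at hk ⊢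
    exact ⟨hk.1, hk.2.trans hji⟩
  · exact hcon (mem_upSet.1 (h (mem_upSet.2 ⟨hi, dominates_refl _ _⟩))).2

theorem topBlock_glue (hT : T ⊆ S) (x y : RSpace n) (hx : signLevel a T (signOn a T x) = 1)
    (ha : ∀ i j, i < j → (a i j).Nonempty) :
    topBlock a S (glue a S T (signOn a T x) (signOn a (S \ T) y)) = T := by
  obtain ⟨⟨k, hk⟩, hdom⟩ := signLevel_eq_one_iff.1 hx
  obtain ⟨z, hz⟩ := exists_signOn_eq_glue (a := a) hT x y
  ext i
  rw [mem_topBlock]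
  constructor
  · rintro ⟨-, h⟩
    by_contra hi
    exact not_dominates_glue hT x y hk hi (h k (hT hk))
  · refine fun hi => ⟨hT hi, fun j hj => ?_⟩
    by_cases hjT : j ∈ T
    · exact (dominates_glue_left hT x y hi hjT).2 (hdom i hi j hjT)
    · rw [← hz]
      refine (dominates_total ha z (hT hi) hj).resolve_right ?_
      rw [hz]
      exact not_dominates_glue hT x y hi hjT

/-- If `x_i - x_j` is unbounded above on the face of `x`, then `x` is on the upper side of all
hyperplanes comparing `i` and `j`. -/
theorem lt_of_not_dominates {x : RSpace n} {i j : Fin n} (hj : j ∈ S) (hi : i ∈ S)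
    (hji : ¬ Dominates a S (signOn a S x) j i) :
    (i < j → ∀ c ∈ a i j, c < x i - x j) ∧ (j < i → ∀ c ∈ a j i, x j - x i < c) := by
  simp only [Dominates, not_exists, not_forall, not_le] at hji
  refine ⟨fun hij c hc => ?_, fun hij c hc => ?_⟩
  · obtain ⟨y, hy, hlt⟩ := hji (-c)
    have h1 : SignType.sign (y i - y j - c) = SignType.sign (x i - x j - c) :=
      signVector_eq_iff.1 hy (i, j, c) (mem_triples.2 ⟨hi, hj, hij, hc⟩)
    rw [sign_pos (by linarith : 0 < y i - y j - c), eq_comm, sign_eq_one_iff] at h1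
    linarith
  · obtain ⟨y, hy, hlt⟩ := hji c
    have h1 : SignType.sign (y j - y i - c) = SignType.sign (x j - x i - c) :=
      signVector_eq_iff.1 hy (j, i, c) (mem_triples.2 ⟨hj, hi, hij, hc⟩)
    rw [sign_neg (by linarith : y j - y i - c < 0), eq_comm, sign_eq_neg_one_iff] at h1
    linarith

/-- Every face is glued from its restrictions to its top block and to the remaining blocks. -/
theorem signOn_eq_glue_topBlock (x : RSpace n) :
    signOn a S x = glue a S (topBlock a S (signOn a S x))
      (signOn a (topBlock a S (signOn a S x)) x)
      (signOn a (S \ topBlock a S (signOn a S x)) x) := by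
  rw [signOn_eq_glue_iff (topBlock_subset _)]
  refine ⟨rfl, rfl, fun i hi j hj => ?_⟩
  obtain ⟨hiS, hi⟩ := mem_topBlock.1 hi
  obtain ⟨hjS, hj⟩ := Finset.mem_sdiff.1 hj
  have hji : ¬ Dominates a S (signOn a S x) j i := fun h =>
    hj (mem_topBlock.2 ⟨hjS, fun k hk => h.trans (hi k hk)⟩)
  exact ⟨fun hij c hc => (lt_of_not_dominates hjS hiS hji).1 hij c hc,
    fun hij c hc => (lt_of_not_dominates hjS hiS hji).2 hij c hc⟩

theorem signLevel_topBlock (ha : ∀ i j, i < j → (a i j).Nonempty) (hS : S.Nonempty)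
    (x : RSpace n) :
    signLevel a (topBlock a S (signOn a S x)) (signOn a (topBlock a S (signOn a S x)) x) = 1 := by
  refine signLevel_eq_one_iff.2 ⟨topBlock_nonempty ha hS x, fun i hi j hj => ?_⟩
  rw [← dominates_glue_left (topBlock_subset _) x x hi hj, ← signOn_eq_glue_topBlock]
  exact (mem_topBlock.1 hi).2 j (topBlock_subset _ hj)

/-- The faces of the subarrangement on `S` with `l` blocks, counted by codimension. -/
def levelPoly (a : Fin n → Fin n → Finset ℝ) (S : Finset (Fin n)) (l : ℕ) : ℚ[X] :=
  ∑ s ∈ braidSigns (triples a S) with signLevel a S s = l, Polynomial.X ^ signCodim s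

/-- Splitting off the top block. -/
theorem levelPoly_succ (ha : ∀ i j, i < j → (a i j).Nonempty) (S : Finset (Fin n)) (l : ℕ) :
    levelPoly a S (l + 1) = ∑ T ∈ S.powerset, levelPoly a T 1 * levelPoly a (S \ T) l := by
  simp only [levelPoly, Finset.sum_mul_sum, ← Finset.sum_product', ← pow_add]
  rw [Finset.sum_sigma']
  symm
  refine Finset.sum_nbij (fun p => glue a S p.1 p.2.1 p.2.2) ?_ ?_ ?_ ?_
  · rintro ⟨T, u, v⟩ h
    simp only [Finset.mem_sigma, Finset.mem_powerset, Finset.mem_product, Finset.mem_filter,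
      mem_braidSigns] at h ⊢
    obtain ⟨hT, ⟨⟨x, rfl⟩, hx⟩, ⟨y, rfl⟩, hy⟩ := h
    refine ⟨exists_signOn_eq_glue hT x y, ?_⟩
    rw [signLevel_glue ha hT, hx, hy, add_comm]
  · rintro ⟨T, u, v⟩ h ⟨T', u', v'⟩ h' heq
    simp only [Finset.coe_sigma, Set.mem_sigma_iff, Finset.mem_coe, Finset.mem_powerset,
      Finset.mem_product, Finset.mem_filter, mem_braidSigns] at h h' heq
    obtain ⟨hT, ⟨⟨x, rfl⟩, hx⟩, ⟨y, rfl⟩, hy⟩ := h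
    obtain ⟨hT', ⟨⟨x', rfl⟩, hx'⟩, ⟨y', rfl⟩, hy'⟩ := h'
    have hTT : T = T' := by
      rw [← topBlock_glue hT x y hx ha, heq, topBlock_glue hT' x' y' hx' ha]
    subst hTT
    obtain ⟨z, hz⟩ := exists_signOn_eq_glue (a := a) hT x y
    obtain ⟨h1, h2, -⟩ := (signOn_eq_glue_iff hT).1 hz
    obtain ⟨h3, h4, -⟩ := (signOn_eq_glue_iff hT).1 (hz.trans heq)
    rw [show braidSign (triples a T) x = braidSign (triples a T) x' from h1.symm.trans h3,
      show braidSign (triples a (S \ T)) y = braidSign (triples a (S \ T)) y' from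
        h2.symm.trans h4]
  · intro s hs
    obtain ⟨h1, hlev⟩ := Finset.mem_filter.1 (Finset.mem_coe.1 hs)
    obtain ⟨x, rfl⟩ := mem_braidSigns.1 h1
    have hS : S.Nonempty := by
      rw [Finset.nonempty_iff_ne_empty]
      rintro rfl
      simp [signLevel] at hlev
    refine ⟨⟨topBlock a S (signOn a S x), signOn a _ x, signOn a _ x⟩, ?_,
      (signOn_eq_glue_topBlock x).symm⟩
    simp only [Finset.coe_sigma, Set.mem_sigma_iff, Finset.mem_coe, Finset.mem_powerset,
      Finset.mem_product, Finset.mem_filter, mem_braidSigns]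
    have h2 := signLevel_topBlock ha hS x
    refine ⟨topBlock_subset _, ⟨⟨x, rfl⟩, h2⟩, ⟨x, rfl⟩, ?_⟩
    have h3 := signLevel_glue ha (topBlock_subset (a := a) (S := S) (signOn a S x)) x x
    rw [← signOn_eq_glue_topBlock, hlev, h2] at h3
    omega
  · rintro ⟨T, u, v⟩ h
    simp only [Finset.mem_sigma, Finset.mem_powerset, Finset.mem_product, Finset.mem_filter,
      mem_braidSigns] at h ⊢
    obtain ⟨hT, ⟨⟨x, rfl⟩, hx⟩, ⟨y, rfl⟩, hy⟩ := h
    rw [signCodim_glue]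

end Gluing

/-! ### Faces as fibres of the sign vector -/

section Faces

variable {n : ℕ} {I : Finset (Fin n × Fin n × ℝ)}

theorem continuous_diffForm (t : Fin n × Fin n × ℝ) :
    Continuous fun x : RSpace n => diffForm t x := by
  simp only [diffForm_apply]
  fun_prop

theorem sign_eq_of_isPreconnected {α : Type*} [TopologicalSpace α] {K : Set α}
    (hK : IsPreconnected K) {g : α → ℝ} (hg : Continuous g) (h0 : ∀ x ∈ K, g x ≠ 0) {x y : α}
    (hx : x ∈ K) (hy : y ∈ K) : SignType.sign (g x) = SignType.sign (g y) := by
  wlog hxy : g x ≤ g y generalizing x y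
  · exact (this hy hx (le_of_not_ge hxy)).symm
  rcases lt_or_gt_of_ne (h0 x hx) with h | h
  · rcases lt_or_gt_of_ne (h0 y hy) with h' | h'
    · rw [sign_neg h, sign_neg h']
    · obtain ⟨z, hz, hz0⟩ := hK.intermediate_value hx hy hg.continuousOn ⟨h.le, h'.le⟩
      exact absurd hz0 (h0 z hz)
  · rw [sign_pos h, sign_pos (h.trans_le hxy)]

/-- The fibre is convex, hence connected, and no functional of the family that is
nonzero on the complement can change sign inside a component. -/
theorem connectedComponentIn_restrictionComplement {X : AffineSubspace ℝ (RSpace n)}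
    (hX : X ∈ flats (tripleArrangement I)) {x : RSpace n}
    (hx : x ∈ restrictionComplement (tripleArrangement I) X) :
    connectedComponentIn (restrictionComplement (tripleArrangement I) X) x =
      {y | braidSign I y = braidSign I x} := by
  have hmem : ∀ y, y ∈ restrictionComplement (tripleArrangement I) X ↔ y ∈ X ∧ ∀ t ∈ I,
      ¬ X ≤ diffHyperplane t.1 t.2.1 t.2.2 → diffForm t y ≠ t.2.2 := by
    intro y
    simp only [restrictionComplement, Set.mem_sdiff, SetLike.mem_coe, Set.mem_iUnion, not_exists]
    refine and_congr_right fun _ => ⟨fun h t ht hXt hy => h _ ⟨⟨t, ht, rfl⟩, hXt⟩ hy, ?_⟩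
    rintro h _ ⟨⟨t, ht, rfl⟩, hXt⟩ hy
    exact h t ht hXt hy
  refine Set.Subset.antisymm ?_ ?_
  · intro y hy
    change braidSign I y = braidSign I x
    rw [signVector_eq_iff]
    intro t ht
    have hsub := connectedComponentIn_subset (restrictionComplement (tripleArrangement I) X) x
    by_cases hXt : X ≤ diffHyperplane t.1 t.2.1 t.2.2
    · have h1 : diffForm t y = t.2.2 := hXt ((hmem y).1 (hsub hy)).1
      have h2 : diffForm t x = t.2.2 := hXt ((hmem x).1 hx).1
      rw [h1, h2]
    · refine sign_eq_of_isPreconnected isPreconnected_connectedComponentIn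
        (g := fun z => diffForm t z - t.2.2) ((continuous_diffForm t).sub continuous_const)
        (fun z hz => sub_ne_zero.2 (((hmem z).1 (hsub hz)).2 t ht hXt)) hy
        (mem_connectedComponentIn hx)
  · refine (convex_signVector_fiber _).isPreconnected.subset_connectedComponentIn rfl ?_
    intro y (hy : braidSign I y = braidSign I x)
    refine (hmem y).2 ⟨?_, fun t ht hXt hyt => ?_⟩
    · rw [← zeroFlat_le_iff hX, hy, zeroFlat_le_iff hX]
      exact hx.1
    · have h1 : braidSign I y t = 0 := signVector_eq_zero_iff.2 ⟨ht, hyt⟩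
      rw [hy] at h1
      exact ((hmem x).1 hx).2 t ht hXt (signVector_eq_zero_iff.1 h1).2

theorem isFace_iff {F : Set (RSpace n)} :
    IsFace (tripleArrangement I) F ↔ ∃ s ∈ braidSigns I, F = {y | braidSign I y = s} := by
  constructor
  · rintro ⟨X, hX, x, hx, rfl⟩
    exact ⟨_, mem_braidSigns.2 ⟨x, rfl⟩, connectedComponentIn_restrictionComplement hX hx⟩
  · rintro ⟨s, hs, rfl⟩
    obtain ⟨x, rfl⟩ := mem_braidSigns.1 hs
    have hx : x ∈ restrictionComplement (tripleArrangement I) (zeroFlat (braidSign I x)) := by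
      refine ⟨mem_zeroFlat_braidSign x, ?_⟩
      simp only [Set.mem_iUnion, not_exists]
      rintro _ ⟨⟨t, ht, rfl⟩, hXt⟩ hxt
      exact hXt fun y hy => mem_zeroFlat.1 hy t (signVector_eq_zero_iff.2 ⟨ht, hxt⟩)
    exact ⟨_, zeroFlat_mem_flats x, x, hx,
      (connectedComponentIn_restrictionComplement (zeroFlat_mem_flats x) hx).symm⟩

theorem faceDim_fiber {s : Fin n × Fin n × ℝ → SignType} (hs : s ∈ braidSigns I) :
    faceDim {y | braidSign I y = s} = Module.finrank ℝ (zeroDirection diffForm s) := by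
  obtain ⟨x, rfl⟩ := mem_braidSigns.1 hs
  have h : vectorSpan ℝ {y | braidSign I y = braidSign I x} =
      zeroDirection diffForm (braidSign I x) := by
    apply le_antisymm
    · rw [vectorSpan, Submodule.span_le]
      rintro _ ⟨y, hy, z, hz, rfl⟩
      have hy : braidSign I y = braidSign I x := hy
      have hz : braidSign I z = braidSign I x := hz
      rw [← hy]
      exact sub_mem_zeroDirection (hy.trans hz.symm)
    · intro u hu
      obtain ⟨ε, hε, hball⟩ := Metric.eventually_nhds_iff.1 (eventually_signVector_eq x hu)
      have h1 : braidSign I (x + (ε / 2) • u) = braidSign I x := hball (by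
        rw [Real.dist_eq, sub_zero, abs_of_pos (by linarith)]; linarith)
      have h2 := vsub_mem_vectorSpan ℝ
        (show x + (ε / 2) • u ∈ {y | braidSign I y = braidSign I x} from h1)
        (show x ∈ {y | braidSign I y = braidSign I x} from rfl)
      rw [vsub_eq_sub, add_sub_cancel_left] at h2
      exact (Submodule.smul_mem_iff _ (by positivity)).1 h2
  rw [faceDim, h]

end Faces

/-! ### The level of a face is its number of blocks -/

section Level

variable {n : ℕ} {a : Fin n → Fin n → Finset ℝ}

/-- A direction of a ray that stays close to `W` lies in `W`. -/
theorem mem_of_infDist_le {E : Type*} [NormedAddCommGroup E] [NormedSpace ℝ E]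
    [FiniteDimensional ℝ E] {W : Submodule ℝ E} {r : ℝ} {y u : E}
    (h : ∀ t : ℝ, 0 ≤ t → Metric.infDist (y + t • u) W ≤ r) : u ∈ W := by
  have hcl : IsClosed (W : Set E) := W.closed_of_finiteDimensional
  rw [← SetLike.mem_coe, ← hcl.closure_eq, Metric.mem_closure_iff]
  intro ε hε
  have hr : 0 ≤ r := Metric.infDist_nonneg.trans (h 0 le_rfl)
  set t := (r + 1 + ‖y‖) / ε with ht
  have ht0 : 0 < t := by positivity
  obtain ⟨w, hw, hlt⟩ := (Metric.infDist_lt_iff ⟨0, W.zero_mem⟩).1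
    ((h t ht0.le).trans_lt (lt_add_one r))
  refine ⟨t⁻¹ • w, W.smul_mem _ hw, ?_⟩
  have h1 : u - t⁻¹ • w = t⁻¹ • ((y + t • u - w) - y) := by
    have : t⁻¹ • (t • u) = u := inv_smul_smul₀ ht0.ne' u
    rw [show y + t • u - w - y = t • u - w by abel, smul_sub, this]
  rw [dist_eq_norm] at hlt ⊢
  rw [h1, norm_smul, norm_inv, Real.norm_of_nonneg ht0.le, inv_mul_lt_iff₀ ht0, ht,
    div_mul_cancel₀ _ hε.ne']
  linarith [norm_sub_le (y + t • u - w) y]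

/-- An up-set of blocks can be moved up without leaving the face: the differences across its
boundary are unbounded above on the face, so they already exceed all the constants in `a`. -/
theorem signOn_shiftOn_upSet {y : RSpace n} {s : Fin n × Fin n × ℝ → SignType}
    (hy : signOn a Finset.univ y = s) (k : Fin n) {r : ℝ} (hr : 0 ≤ r) :
    signOn a Finset.univ (shiftOn (upSet a Finset.univ s k) r y y) = s := by
  subst hy
  set U := upSet a Finset.univ (signOn a Finset.univ y) k with hU
  have key : ∀ i ∈ U, ∀ j ∉ U, ¬ Dominates a Finset.univ (signOn a Finset.univ y) j i :=
    fun i hi j hj h => hj (mem_upSet.2 ⟨Finset.mem_univ _, h.trans (mem_upSet.1 hi).2⟩)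
  rw [signVector_eq_iff]
  rintro ⟨i, j, c⟩ ht
  obtain ⟨-, -, hij, hc⟩ := mem_triples.1 ht
  simp only at hij hc
  simp only [diffForm_apply]
  by_cases hi : i ∈ U <;> by_cases hj : j ∈ U
  · rw [shiftOn_of_mem hi, shiftOn_of_mem hj, add_sub_add_right_eq_sub]
  · have h := (lt_of_not_dominates (Finset.mem_univ _) (Finset.mem_univ _) (key i hi j hj)).1
      hij c hc
    rw [shiftOn_of_mem hi, shiftOn_of_notMem hj, sign_pos (by linarith), sign_pos (by linarith)]
  · have h := (lt_of_not_dominates (Finset.mem_univ _) (Finset.mem_univ _) (key j hj i hi)).2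
      hij c hc
    rw [shiftOn_of_notMem hi, shiftOn_of_mem hj, sign_neg (by linarith), sign_neg (by linarith)]
  · rw [shiftOn_of_notMem hi, shiftOn_of_notMem hj]

/-- The indicator vector of a set of coordinates. -/
def indicatorVec (U : Finset (Fin n)) : RSpace n := WithLp.toLp 2 fun i => if i ∈ U then 1 else 0

theorem shiftOn_self (U : Finset (Fin n)) (r : ℝ) (y : RSpace n) :
    shiftOn U r y y = y + r • indicatorVec U := by
  ext i
  by_cases hi : i ∈ U <;> simp [shiftOn, indicatorVec, hi]

/-- The up-sets form a chain, so their indicator vectors are triangular. -/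
theorem linearIndependent_indicatorVec (s : Fin n × Fin n × ℝ → SignType) :
    LinearIndependent ℝ fun U : (Finset.univ.image (upSet a Finset.univ s) : Finset _) =>
      indicatorVec (U : Finset (Fin n)) := by
  rw [Fintype.linearIndependent_iff]
  intro g hg
  by_contra! hcon
  obtain ⟨U, hU⟩ := hcon
  -- at a point of the lowest block in `V`, only the up-sets containing `V` contribute
  obtain ⟨V, hV, hmax⟩ := (Set.toFinite {U | g U ≠ 0}).exists_maximal ⟨U, hU⟩
  obtain ⟨i, -, hi⟩ := Finset.mem_image.1 V.2
  have h1 := congrArg (fun w : RSpace n => w i) hg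
  simp only [WithLp.ofLp_sum, WithLp.ofLp_smul, Finset.sum_apply, Pi.smul_apply, smul_eq_mul,
    PiLp.zero_apply, indicatorVec, mul_ite, mul_one, mul_zero] at h1
  rw [Finset.sum_eq_single V] at h1
  · rw [if_pos] at h1
    · exact hV h1
    · rw [← hi]
      exact mem_upSet.2 ⟨Finset.mem_univ _, dominates_refl _ _⟩
  · intro W _ hWV
    split_ifs with hiW
    · by_contra hW
      obtain ⟨k, -, hk⟩ := Finset.mem_image.1 W.2
      have hle : V ≤ W := by
        intro j hj
        rw [← hk] at hiW ⊢
        rw [← hi] at hj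
        exact mem_upSet.2 ⟨Finset.mem_univ _, (mem_upSet.1 hj).2.trans (mem_upSet.1 hiW).2⟩
      exact hWV (le_antisymm (hmax hW hle) hle)
    · rfl
  · intro h
    exact absurd (Finset.mem_univ _) h

/-- A subspace at bounded distance from the face contains the indicator vectors of all up-sets. -/
theorem signLevel_le_finrank {s : Fin n × Fin n × ℝ → SignType}
    (hs : s ∈ braidSigns (triples a Finset.univ)) {W : Submodule ℝ (RSpace n)} {r : ℝ}
    (h : ∀ x ∈ {y | signOn a Finset.univ y = s}, Metric.infDist x (W : Set (RSpace n)) ≤ r) :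
    signLevel a Finset.univ s ≤ Module.finrank ℝ W := by
  obtain ⟨y, hy⟩ := mem_braidSigns.1 hs
  have hW : ∀ U : (Finset.univ.image (upSet a Finset.univ s) : Finset _),
      indicatorVec (U : Finset (Fin n)) ∈ W := by
    rintro ⟨U, hU⟩
    obtain ⟨k, -, rfl⟩ := Finset.mem_image.1 hU
    refine mem_of_infDist_le (y := y) (r := r) fun t ht => h _ ?_
    rw [← shiftOn_self]
    exact signOn_shiftOn_upSet hy k ht
  have hli : LinearIndependent ℝ
      fun U : (Finset.univ.image (upSet a Finset.univ s) : Finset _) =>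
        (⟨indicatorVec (U : Finset (Fin n)), hW U⟩ : W) :=
    LinearIndependent.of_comp W.subtype (linearIndependent_indicatorVec s)
  have := hli.fintype_card_le_finrank
  rwa [Fintype.card_coe] at this

/-- The face stays close to the space of vectors that are constant on its blocks. -/
theorem exists_submodule_finrank_le_signLevel (s : Fin n × Fin n × ℝ → SignType) :
    ∃ W : Submodule ℝ (RSpace n), Module.finrank ℝ W ≤ signLevel a Finset.univ s ∧
      ∃ r : ℝ, ∀ x ∈ {y | signOn a Finset.univ y = s},
        Metric.infDist x (W : Set (RSpace n)) ≤ r := by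
  have hrep : ∀ U : (Finset.univ.image (upSet a Finset.univ s) : Finset _),
      ∃ i, upSet a Finset.univ s i = U := fun U => by
    obtain ⟨i, -, hi⟩ := Finset.mem_image.1 U.2
    exact ⟨i, hi⟩
  choose rep hrep using hrep
  let blk : Fin n → (Finset.univ.image (upSet a Finset.univ s) : Finset _) := fun i =>
    ⟨upSet a Finset.univ s i, Finset.mem_image_of_mem _ (Finset.mem_univ _)⟩
  have hdom : ∀ i, Dominates a Finset.univ s i (rep (blk i)) ∧
      Dominates a Finset.univ s (rep (blk i)) i := by
    intro i
    have h1 : upSet a Finset.univ s (rep (blk i)) = upSet a Finset.univ s i := hrep (blk i)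
    have h2 : ∀ k, k ∈ upSet a Finset.univ s k := fun k =>
      mem_upSet.2 ⟨Finset.mem_univ _, dominates_refl _ _⟩
    exact ⟨(mem_upSet.1 (h1 ▸ h2 i)).2, (mem_upSet.1 (h1 ▸ h2 (rep (blk i)))).2⟩
  let f : ((Finset.univ.image (upSet a Finset.univ s) : Finset _) → ℝ) →ₗ[ℝ] RSpace n :=
    { toFun := fun g => WithLp.toLp 2 fun i => g (blk i)
      map_add' := fun g h => by ext i; simp
      map_smul' := fun c g => by ext i; simp }
  refine ⟨LinearMap.range f, ?_, ?_⟩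
  · refine (LinearMap.finrank_range_le f).trans ?_
    rw [Module.finrank_fintype_fun_eq_card, Fintype.card_coe]
    rfl
  · have hb : ∀ i, ∃ r, ∀ y, signOn a Finset.univ y = s → |y i - y (rep (blk i))| ≤ r := by
      intro i
      obtain ⟨⟨r, hr⟩, ⟨q, hq⟩⟩ := hdom i
      refine ⟨max (-r) (-q), fun y hy => abs_le'.2 ⟨?_, ?_⟩⟩
      · exact le_max_of_le_right (by linarith [hq y hy])
      · exact le_max_of_le_left (by linarith [hr y hy])
    choose r hr using hb
    refine ⟨√(∑ i, r i ^ 2), fun y hy => ?_⟩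
    refine (Metric.infDist_le_dist_of_mem (LinearMap.mem_range_self f fun U => y (rep U))).trans ?_
    rw [EuclideanSpace.dist_eq]
    refine Real.sqrt_le_sqrt (Finset.sum_le_sum fun i _ => ?_)
    rw [Real.dist_eq]
    exact pow_le_pow_left₀ (abs_nonneg _) (hr i y hy) 2

theorem level_fiber {s : Fin n × Fin n × ℝ → SignType}
    (hs : s ∈ braidSigns (triples a Finset.univ)) :
    level {y | signOn a Finset.univ y = s} = signLevel a Finset.univ s := by
  obtain ⟨W, hW, r, hr⟩ := exists_submodule_finrank_le_signLevel (a := a) s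
  have hmem : Module.finrank ℝ W ∈ {k | ∃ W : Submodule ℝ (RSpace n), Module.finrank ℝ W = k ∧
      ∃ r : ℝ, ∀ x ∈ {y | signOn a Finset.univ y = s},
        Metric.infDist x (W : Set (RSpace n)) ≤ r} := ⟨W, rfl, r, hr⟩
  apply le_antisymm
  · exact (Nat.sInf_le hmem).trans hW
  · obtain ⟨W', hW', r', hr'⟩ := Nat.sInf_mem ⟨_, hmem⟩
    exact (signLevel_le_finrank hs hr').trans_eq hW'

theorem signLevel_le_finrank_zeroDirection {s : Fin n × Fin n × ℝ → SignType}
    (hs : s ∈ braidSigns (triples a Finset.univ)) :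
    signLevel a Finset.univ s ≤ Module.finrank ℝ (zeroDirection diffForm s) := by
  obtain ⟨x, hx⟩ := mem_braidSigns.1 hs
  refine signLevel_le_finrank hs (r := ‖x‖) fun y (hy : signOn a Finset.univ y = s) => ?_
  have h1 : y - x ∈ zeroDirection diffForm s := by
    rw [← hy]
    exact sub_mem_zeroDirection (hy.trans hx.symm)
  refine (Metric.infDist_le_dist_of_mem (SetLike.mem_coe.2 h1)).trans_eq ?_
  rw [dist_eq_norm, sub_sub_cancel]

theorem faceCount_eq (d l : ℕ) :
    faceCount (tripleArrangement (triples a Finset.univ)) d l =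
      ((braidSigns (triples a Finset.univ)).filter fun s =>
        Module.finrank ℝ (zeroDirection diffForm s) = d ∧ signLevel a Finset.univ s = l).card := by
  have h : facesOf (tripleArrangement (triples a Finset.univ)) d l =
      (fun s => {y | signOn a Finset.univ y = s}) ''
        ((braidSigns (triples a Finset.univ)).filter fun s =>
          Module.finrank ℝ (zeroDirection diffForm s) = d ∧
            signLevel a Finset.univ s = l : Finset _) := by
    ext F
    simp only [facesOf, Set.mem_ofPred_eq, isFace_iff, Set.mem_image, Finset.mem_coe,
      Finset.mem_filter]
    constructor
    · rintro ⟨⟨s, hs, rfl⟩, hd, hl⟩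
      rw [faceDim_fiber hs] at hd
      rw [level_fiber hs] at hl
      exact ⟨s, ⟨hs, hd, hl⟩, rfl⟩
    · rintro ⟨s, ⟨hs, hd, hl⟩, rfl⟩
      exact ⟨⟨s, hs, rfl⟩, (faceDim_fiber hs).trans hd, (level_fiber hs).trans hl⟩
  rw [faceCount, h, Set.InjOn.ncard_image, Set.ncard_coe_finset]
  intro s hs s' _ hss
  obtain ⟨x, hx⟩ := mem_braidSigns.1 (Finset.mem_filter.1 (Finset.mem_coe.1 hs)).1
  have hss : {y | signOn a Finset.univ y = s} = {y | signOn a Finset.univ y = s'} := hss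
  have h1 : x ∈ {y | signOn a Finset.univ y = s'} :=
    hss ▸ (show x ∈ {y | signOn a Finset.univ y = s} from hx)
  exact hx.symm.trans h1

theorem levelPoly_univ_eq (l : ℕ) :
    levelPoly a Finset.univ l = ∑ d ∈ Finset.Icc l n,
      Polynomial.C (faceCount (tripleArrangement (triples a Finset.univ)) d l : ℚ) *
        Polynomial.X ^ (n - d) := by
  classical
  have hmaps : ∀ s ∈ (braidSigns (triples a Finset.univ)).filter
      (fun s => signLevel a Finset.univ s = l),
      Module.finrank ℝ (zeroDirection diffForm s) ∈ Finset.Icc l n := by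
    intro s hs
    obtain ⟨h1, rfl⟩ := Finset.mem_filter.1 hs
    exact Finset.mem_Icc.2 ⟨signLevel_le_finrank_zeroDirection h1, finrank_le _⟩
  rw [levelPoly, ← Finset.sum_fiberwise_of_maps_to hmaps]
  refine Finset.sum_congr rfl fun d _ => ?_
  rw [Finset.filter_filter, faceCount_eq, map_natCast, ← nsmul_eq_mul, ← Finset.sum_const]
  refine Finset.sum_congr (Finset.filter_congr fun s _ => and_comm) fun s hs => ?_
  rw [signCodim, (Finset.mem_filter.1 hs).2.1]

end Level

/-! ### Exponential sequences -/

section Exponential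

theorem direction_diffHyperplane {n : ℕ} {i j : Fin n} (hij : i ≠ j) (c : ℝ) (v : RSpace n) :
    v ∈ (diffHyperplane i j c).direction ↔ v i = v j := by
  have hp : EuclideanSpace.single i c ∈ diffHyperplane i j c := by
    change (EuclideanSpace.single i c : RSpace n) i - (EuclideanSpace.single i c : RSpace n) j = c
    simp [hij.symm]
  rw [← AffineSubspace.vadd_mem_iff_mem_direction v hp]
  change v i + (EuclideanSpace.single i c : RSpace n) i -
    (v j + (EuclideanSpace.single i c : RSpace n) j) = c ↔ _
  simp only [PiLp.single_apply, if_true, if_neg hij.symm]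
  constructor <;> intro h <;> linarith

theorem parallel_diffHyperplane {n : ℕ} {i j : Fin n} (hij : i ≠ j) (c d : ℝ) :
    (diffHyperplane i j c).Parallel (diffHyperplane i j d) := by
  rw [AffineSubspace.parallel_iff_direction_eq_and_eq_bot_iff_eq_bot]
  have hne : ∀ c, diffHyperplane i j c ≠ ⊥ := by
    intro c h
    have hp : EuclideanSpace.single i c ∈ diffHyperplane i j c := by
      change (EuclideanSpace.single i c : RSpace n) i - (EuclideanSpace.single i c : RSpace n) j = c
      simp [hij.symm]
    rw [h] at hp
    exact hp
  refine ⟨?_, iff_of_false (hne c) (hne d)⟩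
  ext v
  rw [direction_diffHyperplane hij, direction_diffHyperplane hij]

theorem mem_of_parallel_diffHyperplane {n : ℕ} {i j p q : Fin n} (hij : i ≠ j) (hpq : p ≠ q)
    {c d : ℝ} (h : (diffHyperplane i j c).Parallel (diffHyperplane p q d)) :
    (i = p ∨ i = q) ∧ (j = p ∨ j = q) := by
  have hdir : ∀ v : RSpace n, v i = v j ↔ v p = v q := fun v => by
    rw [← direction_diffHyperplane hij c, h.direction_eq, direction_diffHyperplane hpq d]
  constructor
  · by_contra! hcon
    have := (hdir (EuclideanSpace.single i 1)).2 (by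
      simp [hcon.1.symm, hcon.2.symm])
    simp [hij.symm] at this
  · by_contra! hcon
    have := (hdir (EuclideanSpace.single j 1)).2 (by
      simp [hcon.1.symm, hcon.2.symm])
    simp [hij] at this

theorem subarrangement_tripleArrangement {n : ℕ} (a : Fin n → Fin n → Finset ℝ)
    (S : Finset (Fin n)) :
    subarrangement (tripleArrangement (triples a Finset.univ)) S =
      tripleArrangement (triples a S) := by
  ext H
  constructor
  · rintro ⟨⟨t, ht, rfl⟩, p, hp, q, hq, hpq, hpar⟩
    obtain ⟨-, -, hlt, hc⟩ := mem_triples.1 ht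
    obtain ⟨h1, h2⟩ := mem_of_parallel_diffHyperplane hlt.ne hpq hpar
    refine ⟨t, mem_triples.2 ⟨?_, ?_, hlt, hc⟩, rfl⟩
    · rcases h1 with h | h <;> rwa [h]
    · rcases h2 with h | h <;> rwa [h]
  · rintro ⟨t, ht, rfl⟩
    obtain ⟨h1, h2, hlt, hc⟩ := mem_triples.1 ht
    exact ⟨⟨t, mem_triples.2 ⟨Finset.mem_univ _, Finset.mem_univ _, hlt, hc⟩, rfl⟩, t.1, h1, t.2.1,
      h2, hlt.ne, parallel_diffHyperplane hlt.ne _ _⟩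

theorem IsDeformedBraid.exists_triples {n : ℕ} {A : Arrangement n} (hA : IsDeformedBraid A) :
    ∃ a : Fin n → Fin n → Finset ℝ, (∀ i j, i < j → (a i j).Nonempty) ∧
      A = tripleArrangement (triples a Finset.univ) := by
  obtain ⟨a, ha, rfl⟩ := hA
  refine ⟨a, ha, ?_⟩
  ext H
  constructor
  · rintro ⟨i, j, hij, c, hc, rfl⟩
    exact ⟨(i, j, c), mem_triples.2 ⟨Finset.mem_univ _, Finset.mem_univ _, hij, hc⟩, rfl⟩
  · rintro ⟨t, ht, rfl⟩
    obtain ⟨-, -, hij, hc⟩ := mem_triples.1 ht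
    exact ⟨t.1, t.2.1, hij, t.2.2, hc, rfl⟩

/-- Only `n ≥ 1` is constrained in an exponential sequence; for `n = 0` the condition on `a 0` is
empty. -/
theorem IsESA.exists_triples {A : ∀ n, Arrangement n} (hA : IsESA A) :
    ∃ a : ∀ n, Fin n → Fin n → Finset ℝ, (∀ n i j, i < j → (a n i j).Nonempty) ∧
      ∀ n, 1 ≤ n → A n = tripleArrangement (triples (a n) Finset.univ) := by
  have h : ∀ n, ∃ a : Fin n → Fin n → Finset ℝ, (∀ i j, i < j → (a i j).Nonempty) ∧
      (1 ≤ n → A n = tripleArrangement (triples a Finset.univ)) := by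
    intro n
    rcases Nat.eq_zero_or_pos n with rfl | hn
    · exact ⟨fun _ _ => ∅, fun i => i.elim0, fun h => absurd h (by decide)⟩
    · obtain ⟨a, h1, h2⟩ := (hA.deformedBraid n hn).exists_triples
      exact ⟨a, h1, fun _ => h2⟩
  choose a h1 h2 using h
  exact ⟨a, h1, h2⟩

theorem levelPoly_eq_zero {n : ℕ} {a : Fin n → Fin n → Finset ℝ} {S : Finset (Fin n)} {l : ℕ}
    (h : S.card < l) : levelPoly a S l = 0 := by
  rw [levelPoly, Finset.filter_false_of_mem, Finset.sum_empty]
  intro s _ hs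
  have := signLevel_le (a := a) (S := S) s
  omega

theorem sum_levelPoly {n : ℕ} {a : Fin n → Fin n → Finset ℝ} {S : Finset (Fin n)}
    (hS : S.Nonempty) :
    ∑ l ∈ Finset.Icc 1 S.card, levelPoly a S l =
      ∑ s ∈ braidSigns (triples a S), Polynomial.X ^ signCodim s :=
  Finset.sum_fiberwise_of_maps_to (g := signLevel a S)
    (fun s _ => Finset.mem_Icc.2 ⟨signLevel_pos hS s, signLevel_le s⟩) _

/-- In an exponential sequence the faces of the subarrangement on `S`, counted by level and
codimension, depend only on `|S|`. The poset gives the total over all levels; the levels above `1`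
come from smaller subsets by splitting off the top block. -/
theorem levelPoly_eq_of_iso {a : ∀ n, Fin n → Fin n → Finset ℝ}
    (ha : ∀ n i j, i < j → (a n i j).Nonempty)
    (hiso : ∀ n (S : Finset (Fin n)), S.Nonempty → Nonempty
      (IntersectionPoset (tripleArrangement (triples (a n) S)) ≃o
        IntersectionPoset (tripleArrangement (triples (a S.card) Finset.univ))))
    (k : ℕ) : ∀ (n : ℕ) (S : Finset (Fin n)), S.card = k → ∀ l, 1 ≤ l →
      levelPoly (a n) S l = levelPoly (a k) Finset.univ l := by
  induction k using Nat.strong_induction_on with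
  | _ k ih =>
    rcases Nat.eq_zero_or_pos k with rfl | hk
    · intro n S hS l hl
      rw [levelPoly_eq_zero (by omega), levelPoly_eq_zero (by simp; omega)]
    have hsucc : ∀ l, 1 ≤ l → ∃ R : ℚ[X], ∀ (n : ℕ) (S : Finset (Fin n)), S.card = k →
        levelPoly (a n) S (l + 1) = R := by
      intro l hl
      -- the extreme terms `T = ∅` and `T = S` vanish, all others are known by induction
      let G : ℕ → ℚ[X] := fun j => if j = 0 ∨ j = k then 0 else
        levelPoly (a j) Finset.univ 1 * levelPoly (a (k - j)) Finset.univ l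
      refine ⟨∑ m ∈ Finset.range (k + 1), k.choose m • G m, fun n S hS => ?_⟩
      rw [levelPoly_succ (ha n)]
      have h : ∀ T ∈ S.powerset,
          levelPoly (a n) T 1 * levelPoly (a n) (S \ T) l = G T.card := by
        intro T hT
        rw [Finset.mem_powerset] at hT
        have h1 : (S \ T).card = k - T.card := by rw [Finset.card_sdiff_of_subset hT, hS]
        have h2 : T.card ≤ k := hS ▸ Finset.card_le_card hT
        by_cases h0 : T.card = 0
        · rw [levelPoly_eq_zero (S := T) (by omega), zero_mul]
          exact (if_pos (Or.inl h0)).symm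
        by_cases h3 : T.card = k
        · rw [levelPoly_eq_zero (S := S \ T) (by omega), mul_zero]
          exact (if_pos (Or.inr h3)).symm
        rw [ih T.card (by omega) n T rfl 1 le_rfl, ih (k - T.card) (by omega) n (S \ T) h1 l hl]
        exact (if_neg (not_or.2 ⟨h0, h3⟩)).symm
      rw [Finset.sum_congr rfl h, Finset.sum_powerset_apply_card, hS]
    have huniv : (Finset.univ : Finset (Fin k)).card = k := Finset.card_fin k
    have hge : ∀ (n : ℕ) (S : Finset (Fin n)), S.card = k → ∀ l, 2 ≤ l →
        levelPoly (a n) S l = levelPoly (a k) Finset.univ l := by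
      intro n S hS l hl
      obtain ⟨m, rfl⟩ : ∃ m, l = m + 1 := ⟨l - 1, by omega⟩
      obtain ⟨R, hR⟩ := hsucc m (by omega)
      rw [hR n S hS, hR k Finset.univ huniv]
    intro n S hS l hl
    -- at level `1`, subtract the higher levels from the total
    rcases hl.eq_or_lt with rfl | hl
    · have hSne : S.Nonempty := Finset.card_pos.1 (hS ▸ hk)
      obtain ⟨e⟩ := hiso n S hSne
      have htot := sum_X_pow_signCodim_eq e
      rw [← sum_levelPoly hSne, hS,
        ← sum_levelPoly (Finset.card_pos.1 (by rwa [huniv])), huniv] at htot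
      have h1 : 1 ∈ Finset.Icc 1 k := Finset.mem_Icc.2 ⟨le_rfl, hk⟩
      rw [← Finset.add_sum_erase _ _ h1, ← Finset.add_sum_erase _ _ h1] at htot
      have h2 : ∀ l ∈ (Finset.Icc 1 k).erase 1,
          levelPoly (a n) S l = levelPoly (a k) Finset.univ l := by
        intro l hl
        rw [Finset.mem_erase, Finset.mem_Icc] at hl
        exact hge n S hS l (by omega)
      rw [Finset.sum_congr rfl h2] at htot
      exact add_right_cancel htot
    · exact hge n S hS l hl

/-- The exponential convolution: the top block is an arbitrary subset, and only its size matters. -/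
theorem levelPoly_succ_eq_sum_choose {a : ∀ n, Fin n → Fin n → Finset ℝ}
    (ha : ∀ n i j, i < j → (a n i j).Nonempty)
    (hiso : ∀ n (S : Finset (Fin n)), S.Nonempty → Nonempty
      (IntersectionPoset (tripleArrangement (triples (a n) S)) ≃o
        IntersectionPoset (tripleArrangement (triples (a S.card) Finset.univ))))
    (n l : ℕ) (hl : 1 ≤ l) :
    levelPoly (a n) Finset.univ (l + 1) =
      ∑ p ∈ Finset.HasAntidiagonal.antidiagonal n, n.choose p.1 •
      (levelPoly (a p.1) Finset.univ 1 * levelPoly (a p.2) Finset.univ l) := by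
  rw [levelPoly_succ (ha n), Finset.Nat.sum_antidiagonal_eq_sum_range_succ_mk]
  have h : ∀ T ∈ (Finset.univ : Finset (Fin n)).powerset,
      levelPoly (a n) T 1 * levelPoly (a n) (Finset.univ \ T) l =
        levelPoly (a T.card) Finset.univ 1 * levelPoly (a (n - T.card)) Finset.univ l := by
    intro T _
    rw [levelPoly_eq_of_iso ha hiso T.card n T rfl 1 le_rfl,
      levelPoly_eq_of_iso ha hiso (n - T.card) n (Finset.univ \ T) (by
        rw [Finset.card_sdiff_of_subset (Finset.subset_univ T), Finset.card_fin]) l hl]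
  rw [Finset.sum_congr rfl h, Finset.sum_powerset_apply_card (fun j =>
    levelPoly (a j) Finset.univ 1 * levelPoly (a (n - j)) Finset.univ l), Finset.card_fin]

theorem coeff_levelGF {A : ∀ n, Arrangement n} {a : ∀ n, Fin n → Fin n → Finset ℝ}
    (hA : ∀ n, 1 ≤ n → A n = tripleArrangement (triples (a n) Finset.univ)) {l : ℕ} (hl : 1 ≤ l)
    (n : ℕ) : PowerSeries.coeff n (levelGF A l) =
      Polynomial.C ((n.factorial : ℚ)⁻¹) * levelPoly (a n) Finset.univ l := by
  rw [levelGF, PowerSeries.coeff_mk]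
  rcases Nat.eq_zero_or_pos n with rfl | hn
  · rw [levelPoly_eq_zero (by simp; omega), Finset.Icc_eq_empty (by omega), Finset.sum_empty,
      mul_zero]
  · rw [levelPoly_univ_eq, Finset.mul_sum, hA n hn]
    refine Finset.sum_congr rfl fun d _ => ?_
    rw [← mul_assoc, ← Polynomial.C_mul, div_eq_inv_mul]

/-! ### The generating function and its coefficients -/

theorem IsESA.levelGF_eq_pow {A : ∀ n, Arrangement n} (hA : IsESA A) {l : ℕ} (hl : 1 ≤ l) :
    levelGF A l = levelGF A 1 ^ l := by
  obtain ⟨a, ha, hAa⟩ := hA.exists_triples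
  have hiso : ∀ n (S : Finset (Fin n)), S.Nonempty → Nonempty
      (IntersectionPoset (tripleArrangement (triples (a n) S)) ≃o
        IntersectionPoset (tripleArrangement (triples (a S.card) Finset.univ))) := by
    intro n S hS
    have hcard : 1 ≤ S.card := hS.card_pos
    have hn : 1 ≤ n := hcard.trans ((Finset.card_le_univ S).trans_eq (Fintype.card_fin n))
    have h := hA.iso n hn S hS
    rwa [hAa n hn, hAa _ hcard, subarrangement_tripleArrangement] at h
  induction l, hl using Nat.le_induction with
  | base => rw [pow_one]
  | succ l hl ih =>
    rw [pow_succ', ← ih]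
    ext1 n
    rw [PowerSeries.coeff_mul, coeff_levelGF hAa (by omega),
      levelPoly_succ_eq_sum_choose ha hiso n l hl, Finset.mul_sum]
    refine Finset.sum_congr rfl fun p hp => ?_
    have hn : p.1 + p.2 = n := Finset.HasAntidiagonal.mem_antidiagonal.1 hp
    rw [coeff_levelGF hAa le_rfl, coeff_levelGF hAa hl, nsmul_eq_mul, ← map_natCast Polynomial.C]
    have hc : (n.factorial : ℚ)⁻¹ * (n.choose p.1 : ℚ) =
        (p.1.factorial : ℚ)⁻¹ * (p.2.factorial : ℚ)⁻¹ := by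
      have h := Nat.add_choose_mul_factorial_mul_factorial p.2 p.1
      rw [add_comm, hn, mul_right_comm] at h
      have h' : (n.choose p.1 : ℚ) * p.1.factorial * p.2.factorial = n.factorial := by
        exact_mod_cast h
      have h1 : (p.1.factorial : ℚ) ≠ 0 := by positivity
      have h2 : (p.2.factorial : ℚ) ≠ 0 := by positivity
      have h3 : (n.factorial : ℚ) ≠ 0 := by positivity
      field_simp
      linarith
    rw [← mul_assoc, ← Polynomial.C_mul, hc, Polynomial.C_mul]
    ring

theorem coeff_pow_eq_sum_piAntidiag {R : Type*} [CommSemiring R] (f : PowerSeries R) (l n : ℕ) :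
    PowerSeries.coeff n (f ^ l) =
      ∑ ν ∈ Finset.piAntidiag (Finset.univ : Finset (Fin l)) n, ∏ i, PowerSeries.coeff (ν i) f := by
  have h : f ^ l = ∏ _i : Fin l, f := by simp
  rw [h, PowerSeries.coeff_prod]
  refine Finset.sum_nbij (fun ν => ⇑ν) ?_ ?_ ?_ ?_
  · intro ν hν
    rw [Finset.mem_finsuppAntidiag] at hν
    exact Finset.mem_piAntidiag.2 ⟨hν.1, fun i _ => Finset.mem_univ i⟩
  · exact fun _ _ _ _ h => DFunLike.coe_injective h
  · intro ν hν
    refine ⟨Finsupp.equivFunOnFinite.symm ν, ?_, rfl⟩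
    exact Finset.mem_coe.2 (Finset.mem_finsuppAntidiag.2
      ⟨(Finset.mem_piAntidiag.1 (Finset.mem_coe.1 hν)).1, Finset.subset_univ _⟩)
  · exact fun _ _ => rfl

/-- The coefficient of `x ^ (n - d)` in a product of polynomials `∑ c_δ x ^ (ν - δ)`. -/
theorem coeff_prod_sum_Icc {l n d : ℕ} (hd : d ≤ n) (ν : Fin l → ℕ) (hν : ∑ i, ν i = n)
    (c : Fin l → ℕ → ℚ) :
    (∏ i, ∑ δ ∈ Finset.Icc 1 (ν i), Polynomial.C (c i δ) * Polynomial.X ^ (ν i - δ)).coeff (n - d) =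
      ∑ δ ∈ (Finset.piAntidiag (Finset.univ : Finset (Fin l)) d).filter
          (fun δ => ∀ i, 1 ≤ δ i ∧ δ i ≤ ν i), ∏ i, c i (δ i) := by
  rw [Finset.prod_univ_sum, Polynomial.finsetSum_coeff]
  have h : ∀ δ ∈ Fintype.piFinset fun i => Finset.Icc 1 (ν i),
      (∏ i, Polynomial.C (c i (δ i)) * (Polynomial.X : ℚ[X]) ^ (ν i - δ i)).coeff (n - d) =
        if ∑ i, δ i = d then ∏ i, c i (δ i) else 0 := by
    intro δ hδ
    have hδ' : ∀ i ∈ Finset.univ, δ i ≤ ν i := fun i _ =>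
      (Finset.mem_Icc.1 (Fintype.mem_piFinset.1 hδ i)).2
    rw [Finset.prod_mul_distrib, Finset.prod_pow_eq_pow_sum, ← map_prod, Polynomial.coeff_C_mul,
      Polynomial.coeff_X_pow, Finset.sum_tsub_distrib _ hδ', hν, mul_ite, mul_one, mul_zero]
    have hle : ∑ i, δ i ≤ n := hν ▸ Finset.sum_le_sum hδ'
    refine if_congr ?_ rfl rfl
    omega
  rw [Finset.sum_congr rfl h, ← Finset.sum_filter]
  refine Finset.sum_congr ?_ fun _ _ => rfl
  ext δ
  simp only [Finset.mem_filter, Fintype.mem_piFinset, Finset.mem_Icc, Finset.mem_piAntidiag]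
  constructor
  · rintro ⟨h1, h2⟩
    exact ⟨⟨h2, fun i _ => Finset.mem_univ i⟩, h1⟩
  · rintro ⟨⟨h1, -⟩, h2⟩
    exact ⟨h2, h1⟩

/-- Comparing the coefficients of `x ^ (n - d) y ^ n` in `F_l = F_1 ^ l`. -/
theorem faceCount_eq_of_levelGF_eq_pow {A : ∀ n, Arrangement n} {l : ℕ}
    (h : levelGF A l = levelGF A 1 ^ l) {n d : ℕ} (hld : l ≤ d) (hdn : d ≤ n) :
    faceCount (A n) d l =
      ∑ ν ∈ Finset.piAntidiag (Finset.univ : Finset (Fin l)) n,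
        ∑ δ ∈ (Finset.piAntidiag (Finset.univ : Finset (Fin l)) d).filter
            (fun δ => ∀ i, 1 ≤ δ i ∧ δ i ≤ ν i),
          Nat.multinomial Finset.univ ν * ∏ i, faceCount (A (ν i)) (δ i) 1 := by
  have h1 := congrArg (fun f => (PowerSeries.coeff n f).coeff (n - d)) h
  simp only [coeff_pow_eq_sum_piAntidiag, levelGF, PowerSeries.coeff_mk,
    Polynomial.finsetSum_coeff] at h1
  rw [Finset.sum_eq_single d] at h1
  · rw [Polynomial.coeff_C_mul_X_pow, if_pos rfl] at h1
    have hn : (n.factorial : ℚ) ≠ 0 := by positivity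
    rw [div_eq_iff hn, Finset.sum_mul] at h1
    have h2 : (faceCount (A n) d l : ℚ) =
        ((∑ ν ∈ Finset.piAntidiag (Finset.univ : Finset (Fin l)) n,
          ∑ δ ∈ (Finset.piAntidiag (Finset.univ : Finset (Fin l)) d).filter
            (fun δ => ∀ i, 1 ≤ δ i ∧ δ i ≤ ν i),
          Nat.multinomial Finset.univ ν * ∏ i, faceCount (A (ν i)) (δ i) 1 : ℕ) : ℚ) := by
      rw [h1, Nat.cast_sum]
      refine Finset.sum_congr rfl fun ν hν => ?_
      have hν' : ∑ i, ν i = n := (Finset.mem_piAntidiag.1 hν).1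
      rw [coeff_prod_sum_Icc hdn ν hν', Finset.sum_mul, Nat.cast_sum]
      refine Finset.sum_congr rfl fun δ _ => ?_
      have h3 : (∏ i, ((ν i).factorial : ℚ)) * Nat.multinomial Finset.univ ν = n.factorial := by
        exact_mod_cast hν' ▸ Nat.multinomial_spec Finset.univ ν
      have h4 : (∏ i, ((ν i).factorial : ℚ)) ≠ 0 :=
        Finset.prod_ne_zero_iff.2 fun i _ => by positivity
      rw [Finset.prod_div_distrib, ← h3]
      push_cast
      field_simp
    exact_mod_cast h2
  · intro d' hd' hne
    rw [Polynomial.coeff_C_mul_X_pow, if_neg]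
    have := (Finset.mem_Icc.1 hd').2
    omega
  · intro h'
    exact absurd (Finset.mem_Icc.2 ⟨hld, hdn⟩) h'

end Exponential

end

theorem theorem1 (A : ∀ n : ℕ, Arrangement n) (hA : IsESA A) (l : ℕ) (hl : 1 ≤ l) :
    levelGF A l = levelGF A 1 ^ l ∧
    ∀ n d : ℕ, l ≤ d → d ≤ n →
      faceCount (A n) d l =
        ∑ ν ∈ Finset.piAntidiag (Finset.univ : Finset (Fin l)) n,
          ∑ δ ∈ (Finset.piAntidiag (Finset.univ : Finset (Fin l)) d).filter
              (fun δ => ∀ i, 1 ≤ δ i ∧ δ i ≤ ν i),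
            Nat.multinomial Finset.univ ν * ∏ i, faceCount (A (ν i)) (δ i) 1 :=
  ⟨hA.levelGF_eq_pow hl, fun _ _ => faceCount_eq_of_levelGF_eq_pow (hA.levelGF_eq_pow hl)⟩
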